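/- **Corollary 3.1 (absolute parallelisms).** Let $M$ be a simply connected (in particular connected) smooth finite-dimensional manifold, and let $\nabla$ be a smooth affine connection on $TM$. Let $\nabla^*$ be its dual connection, defined by $$\nabla^*_XY=\nabla_YX+[X,Y]$$ for all smooth vector fields $X,Y$ on $M$. Suppose that both $\nabla$ and $\nabla^*$ are flat, i.e. have zero curvature. Then there exist a finite-dimensional real Lie algebra $\mathfrak g_0$ and an absolute parallelism $\omega\in\Omega^1(M,\mathfrak g_0)$, that is, a smooth $\mathfrak g_0$-valued one-form such that $\omega\colon T_mM\to\mathfrak g_0$ is a linear isomorphism for every $m\in M$, with the following properties. The form $\omega$ satisfies the Maurer–Cartan equation $$d\omega+\tfrac12[\omega,\omega]_{\mathfrak g_0}=0,$$ and for all smooth vector fields $X,Y$ on $M$, $$\omega(\nabla_XY)=(\mathcal L_Y\omega)(X)\qquad\text{and}\qquad \omega(\nabla^*_XY)=\mathcal L_X(\omega(Y)).$$ Here $\mathcal L$ denotes the Lie derivative, $d\omega(X,Y)=X(\omega(Y))-Y(\omega(X))-\omega([X,Y])$ and $[\omega,\omega]_{\mathfrak g_0}(X,Y)=2[\omega(X),\omega(Y)]_{\mathfrak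 g_0}$. -/

import Mathlib

open scoped Manifold ContDiff

universe u v

noncomputable section

namespace DualConnections

/-- A Lie ring carrying a norm compatible with its additive group. -/
class NormedLieRing (L : Type*) extends NormedAddCommGroup L, LieRing L

/-- A real Lie algebra whose underlying real vector space is a normed space. The norm has no
relation to the bracket. It is used on finite-dimensional Lie algebras only, where all norms are
equivalent and just record the canonical smooth structure of the vector space. -/
class NormedLieAlgebra (L : Type*) [NormedLieRing L] extends NormedSpace ℝ L, LieAlgebra ℝ L

section

variable {E : Type*} [NormedAddCommGroup E] [NormedSpace ℝ E]
  {M : Type*} [TopologicalSpace M] [ChartedSpace E M] [IsManifold 𝓘(ℝ, E) ∞ M]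

/-- `X` is a smooth vector field on `M`. -/
def IsSmoothField (X : Π x : M, TangentSpace 𝓘(ℝ, E) x) : Prop :=
  ContMDiff 𝓘(ℝ, E) 𝓘(ℝ, E).tangent ∞
    (fun x ↦ (⟨x, X x⟩ : TangentBundle 𝓘(ℝ, E) M))

/-- The vector field `∇_X Y`. -/
def nabla (D : CovariantDerivative 𝓘(ℝ, E) E (TangentSpace 𝓘(ℝ, E) : M → Type _))
    (X Y : Π x : M, TangentSpace 𝓘(ℝ, E) x) : Π x : M, TangentSpace 𝓘(ℝ, E) x :=
  fun x ↦ D Y x (X x)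

/-- `D'` is the dual of `D`: `D'_X Y = D_Y X + [X, Y]` for all smooth vector fields. -/
def IsDualPair (D D' : CovariantDerivative 𝓘(ℝ, E) E (TangentSpace 𝓘(ℝ, E) : M → Type _)) :
    Prop :=
  ∀ X Y : Π x : M, TangentSpace 𝓘(ℝ, E) x, IsSmoothField X → IsSmoothField Y → ∀ x,
    nabla D' X Y x = nabla D Y X x + VectorField.mlieBracket 𝓘(ℝ, E) X Y x

/-- `D` is flat: `D_X D_Y Z - D_Y D_X Z - D_[X,Y] Z = 0` for all smooth vector fields. -/
def IsFlat (D : CovariantDerivative 𝓘(ℝ, E) E (TangentSpace 𝓘(ℝ, E) : M → Type _)) : Prop :=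
  ∀ X Y Z : Π x : M, TangentSpace 𝓘(ℝ, E) x,
    IsSmoothField X → IsSmoothField Y → IsSmoothField Z → ∀ x,
      nabla D X (nabla D Y Z) x - nabla D Y (nabla D X Z) x
        - nabla D (VectorField.mlieBracket 𝓘(ℝ, E) X Y) Z x = 0

variable {V : Type*} [NormedAddCommGroup V] [NormedSpace ℝ V]

/-- The pointwise linear form `θ` is a smooth `V`-valued one-form on `M`, i.e. smooth as a map
`TM → V`. -/
def IsSmoothOneForm (θ : Π x : M, TangentSpace 𝓘(ℝ, E) x →L[ℝ] V) : Prop :=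
  ContMDiff 𝓘(ℝ, E).tangent 𝓘(ℝ, V) ∞
    (fun p : TangentBundle 𝓘(ℝ, E) M ↦ θ p.proj p.snd)

/-- An absolute parallelism with values in `V`: a smooth one-form that restricts to an isomorphism
`T_x M → V` at every point. -/
def IsAbsoluteParallelism (θ : Π x : M, TangentSpace 𝓘(ℝ, E) x →L[ℝ] V) : Prop :=
  IsSmoothOneForm θ ∧ ∀ x, Function.Bijective (θ x)

/-- The Lie derivative `L_X f = df(X)` of a `V`-valued function. -/
def lieDerivFun (X : Π x : M, TangentSpace 𝓘(ℝ, E) x) (f : M → V) : M → V :=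
  fun x ↦ mvfderiv 𝓘(ℝ, E) f x (X x)

/-- The function `θ(X)`. -/
def pairing (θ : Π x : M, TangentSpace 𝓘(ℝ, E) x →L[ℝ] V)
    (X : Π x : M, TangentSpace 𝓘(ℝ, E) x) : M → V :=
  fun x ↦ θ x (X x)

/-- The Lie derivative of a one-form along `X`, evaluated on `Y`:
`(L_X θ)(Y) = L_X (θ(Y)) - θ([X, Y])`. -/
def lieDerivForm (X : Π x : M, TangentSpace 𝓘(ℝ, E) x)
    (θ : Π x : M, TangentSpace 𝓘(ℝ, E) x →L[ℝ] V)
    (Y : Π x : M, TangentSpace 𝓘(ℝ, E) x) : M → V :=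
  fun x ↦ lieDerivFun X (pairing θ Y) x - pairing θ (VectorField.mlieBracket 𝓘(ℝ, E) X Y) x

/-- The exterior derivative of a one-form, evaluated on vector fields:
`dθ(X, Y) = X(θ(Y)) - Y(θ(X)) - θ([X, Y])`. -/
def extDerivForm (θ : Π x : M, TangentSpace 𝓘(ℝ, E) x →L[ℝ] V)
    (X Y : Π x : M, TangentSpace 𝓘(ℝ, E) x) : M → V :=
  fun x ↦ lieDerivFun X (pairing θ Y) x - lieDerivFun Y (pairing θ X) x
    - pairing θ (VectorField.mlieBracket 𝓘(ℝ, E) X Y) x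

/-- The bracket of Lie-algebra-valued one-forms, evaluated on vector fields:
`[α, β](X, Y) = [α(X), β(Y)] - [α(Y), β(X)]`. -/
def formBracket {L : Type*} [NormedLieRing L] [NormedLieAlgebra L]
    (α β : Π x : M, TangentSpace 𝓘(ℝ, E) x →L[ℝ] L)
    (X Y : Π x : M, TangentSpace 𝓘(ℝ, E) x) : M → L :=
  fun x ↦ ⁅pairing α X x, pairing β Y x⁆ - ⁅pairing α Y x, pairing β X x⁆

/-- The Maurer–Cartan equation `dθ + (1/2) [θ, θ] = 0`. -/
def MaurerCartan {L : Type*} [NormedLieRing L] [NormedLieAlgebra L]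
    (θ : Π x : M, TangentSpace 𝓘(ℝ, E) x →L[ℝ] L) : Prop :=
  ∀ X Y : Π x : M, TangentSpace 𝓘(ℝ, E) x, IsSmoothField X → IsSmoothField Y → ∀ x,
    extDerivForm θ X Y x + (1 / 2 : ℝ) • formBracket θ θ X Y x = 0

end

end DualConnections

end

/-! Flatness of `D'` on a simply connected manifold gives a global parallel coframe `a`, and `θ = a`
is the parallelism. The identity for `D'` says precisely that `a` is parallel; the one for `D` then
follows from duality.

The bracket on `E` comes from the dual frame `P u = a⁻¹ u`. Since `D' (P u) = 0`, duality gives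
`D_{P u} Z = [P u, Z]`. Vanishing curvature of `D` on `P u, P v, P w`, compared with the Jacobi
identity, leaves `D'_{P w} [P u, P v] = 0` (`IsDualPair.covariantDerivative_mlieBracket`). Hence `[P
u, P v]` is parallel and has constant components `β u v` (`IsDualPair.mlieBracket_eq`), and `β`
inherits the Lie algebra axioms from vector fields. For a parallel coframe, `dθ(X, Y)` is `θ` of the
torsion of `D'`; by tensoriality it can be computed on the frame, where it equals `-β`. This is the
Maurer–Cartan equation.

Local parallel coframes are solutions of `dα = α Γ`, with `Γ` the connection form in coordinates.
The equation is solved along rays by a Picard series, and flatness propagates it to all directions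
(`exists_transport_of_flat`). Two local coframes differ by a locally constant gauge transformation,
and simple connectedness turns this cocycle into a coboundary
(`exists_coboundary_of_locallyConstant_cocycle`). -/

namespace DualConnections

/-! ### Integrals depending on a parameter. -/

section ParametricIntegral

open Set Filter MeasureTheory Topology Interval

variable {E : Type*} [NormedAddCommGroup E] [NormedSpace ℝ E]
  {F : Type*} [NormedAddCommGroup F] [NormedSpace ℝ F]

omit [NormedSpace ℝ E] [NormedSpace ℝ F] in
theorem intervalIntegrable_of_continuousOn_Icc_prod {U : Set E} {g : ℝ → E → F}
    (hg : ContinuousOn (fun p : ℝ × E ↦ g p.1 p.2) (Icc 0 1 ×ˢ U)) {s : ℝ} (hs : s ∈ Icc (0 : ℝ) 1)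
    {x : E} (hx : x ∈ U) : IntervalIntegrable (fun t ↦ g t x) volume 0 s := by
  apply ContinuousOn.intervalIntegrable
  rw [uIcc_of_le hs.1]
  exact hg.comp (f := fun t : ℝ ↦ (t, x)) (by fun_prop) fun t ht ↦ ⟨⟨ht.1, ht.2.trans hs.2⟩, hx⟩

omit [NormedSpace ℝ E] in
theorem continuousOn_integral_param {U : Set E} (hU : IsOpen U) {g : ℝ → E → F} {C : ℝ}
    (hg : ContinuousOn (fun p : ℝ × E ↦ g p.1 p.2) (Icc 0 1 ×ˢ U))
    (hC : ∀ t ∈ Icc (0 : ℝ) 1, ∀ x ∈ U, ‖g t x‖ ≤ C) {s : ℝ} (hs : s ∈ Icc (0 : ℝ) 1) :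
    ContinuousOn (fun x ↦ ∫ t in 0..s, g t x) U := by
  intro x hx
  apply ContinuousAt.continuousWithinAt
  have hIoc : Ι (0 : ℝ) s ⊆ Icc 0 1 := by
    rw [uIoc_of_le hs.1]; exact fun t ht ↦ ⟨ht.1.le, ht.2.trans hs.2⟩
  apply intervalIntegral.continuousAt_of_dominated_interval (bound := fun _ ↦ C)
  · filter_upwards [hU.mem_nhds hx] with y hy
    exact (intervalIntegrable_of_continuousOn_Icc_prod hg hs hy).def'.aestronglyMeasurable
  · filter_upwards [hU.mem_nhds hx] with y hy
    exact .of_forall fun t ht ↦ hC t (hIoc ht) y hy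
  · exact intervalIntegrable_const
  · refine .of_forall fun t ht ↦ ?_
    exact (hg.comp (f := fun y : E ↦ (t, y)) (s := U) (by fun_prop)
      fun y hy ↦ ⟨hIoc ht, hy⟩).continuousAt (hU.mem_nhds hx)

theorem hasFDerivAt_integral_param {U : Set E} (hU : IsOpen U) {g : ℝ → E → F}
    {g' : ℝ → E → E →L[ℝ] F} {C : ℝ}
    (hg : ContinuousOn (fun p : ℝ × E ↦ g p.1 p.2) (Icc 0 1 ×ˢ U))
    (hg' : ContinuousOn (fun p : ℝ × E ↦ g' p.1 p.2) (Icc 0 1 ×ˢ U))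
    (hC : ∀ t ∈ Icc (0 : ℝ) 1, ∀ x ∈ U, ‖g' t x‖ ≤ C)
    (hd : ∀ t ∈ Icc (0 : ℝ) 1, ∀ x ∈ U, HasFDerivAt (g t) (g' t x) x)
    {s : ℝ} (hs : s ∈ Icc (0 : ℝ) 1) {x : E} (hx : x ∈ U) :
    HasFDerivAt (fun x ↦ ∫ t in 0..s, g t x) (∫ t in 0..s, g' t x) x := by
  have hIoc : Ι (0 : ℝ) s ⊆ Icc 0 1 := by
    rw [uIoc_of_le hs.1]; exact fun t ht ↦ ⟨ht.1.le, ht.2.trans hs.2⟩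
  apply intervalIntegral.hasFDerivAt_integral_of_dominated_of_fderiv_le
    (F := fun x t ↦ g t x) (F' := fun x t ↦ g' t x) (bound := fun _ ↦ C) (hU.mem_nhds hx)
  · filter_upwards [hU.mem_nhds hx] with y hy
    exact (intervalIntegrable_of_continuousOn_Icc_prod hg hs hy).def'.aestronglyMeasurable
  · exact intervalIntegrable_of_continuousOn_Icc_prod hg hs hx
  · exact (intervalIntegrable_of_continuousOn_Icc_prod hg' hs hx).def'.aestronglyMeasurable
  · exact .of_forall fun t ht y hy ↦ hC t (hIoc ht) y hy
  · exact intervalIntegrable_const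
  · exact .of_forall fun t ht y hy ↦ hd t (hIoc ht) y hy

end ParametricIntegral

/-! ### The transport equation `dα = α Γ` on a ball. -/

section RadialTransport

open Set Filter MeasureTheory Topology Metric Interval

variable {E : Type*} [NormedAddCommGroup E] [NormedSpace ℝ E]
  {A : Type*} [NormedRing A] [NormedAlgebra ℝ A]

/-- The integrand `f(tx) Γ(tx)(x)` of the radial transport equation. -/
noncomputable def radialIntegrand (Γ : E → E →L[ℝ] A) (f : E → A) (t : ℝ) (x : E) : A :=
  f (t • x) * Γ (t • x) x

/-- The derivative in `x` of `radialIntegrand`, where `f'` and `Γ'` are the derivatives of `f`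
and `Γ`. -/
noncomputable def radialIntegrandDeriv (Γ : E → E →L[ℝ] A) (Γ' : E → E →L[ℝ] E →L[ℝ] A)
    (f : E → A) (f' : E → E →L[ℝ] A) (t : ℝ) (x : E) : E →L[ℝ] A :=
  (ContinuousLinearMap.mul ℝ A (f (t • x))).comp
      (Γ (t • x) + t • (Γ' (t • x)).flip x) +
    t • ((ContinuousLinearMap.mul ℝ A).flip (Γ (t • x) x)).comp (f' (t • x))

theorem radialIntegrandDeriv_apply (Γ : E → E →L[ℝ] A) (Γ' : E → E →L[ℝ] E →L[ℝ] A)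
    (f : E → A) (f' : E → E →L[ℝ] A) (t : ℝ) (x h : E) :
    radialIntegrandDeriv Γ Γ' f f' t x h =
      f (t • x) * (Γ (t • x) h + t • Γ' (t • x) h x) + t • (f' (t • x) h * Γ (t • x) x) := by
  simp [radialIntegrandDeriv, mul_add]

theorem hasFDerivAt_radialIntegrand {Γ : E → E →L[ℝ] A} {Γ' : E → E →L[ℝ] E →L[ℝ] A}
    {f : E → A} {f' : E → E →L[ℝ] A} {t : ℝ} {x : E}
    (hf : HasFDerivAt f (f' (t • x)) (t • x)) (hΓ : HasFDerivAt Γ (Γ' (t • x)) (t • x)) :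
    HasFDerivAt (radialIntegrand Γ f t) (radialIntegrandDeriv Γ Γ' f f' t x) x := by
  have ht : HasFDerivAt (fun x : E ↦ t • x) (t • ContinuousLinearMap.id ℝ E) x :=
    (hasFDerivAt_id x).const_smul t
  have h1 := hf.comp x ht
  have h2 := (hΓ.comp x ht).clm_apply (hasFDerivAt_id x)
  refine (h1.mul' h2).congr_fderiv ?_
  ext h
  simp [radialIntegrandDeriv_apply, mul_add]

theorem smul_mem_ball_zero {r t : ℝ} (ht : t ∈ Icc (0 : ℝ) 1) {x : E} (hx : x ∈ ball (0 : E) r) :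
    t • x ∈ ball (0 : E) r := by
  rw [mem_ball_zero_iff] at hx ⊢
  rw [norm_smul, Real.norm_of_nonneg ht.1]
  exact (mul_le_of_le_one_left (norm_nonneg x) ht.2).trans_lt hx

theorem continuousOn_radialIntegrand {Γ : E → E →L[ℝ] A} {f : E → A} {r : ℝ}
    (hf : ContinuousOn f (ball 0 r)) (hΓ : ContinuousOn Γ (ball 0 r)) :
    ContinuousOn (fun p : ℝ × E ↦ radialIntegrand Γ f p.1 p.2) (Icc 0 1 ×ˢ ball 0 r) := by
  have hm : MapsTo (fun p : ℝ × E ↦ p.1 • p.2) (Icc 0 1 ×ˢ ball 0 r) (ball 0 r) :=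
    fun p hp ↦ smul_mem_ball_zero hp.1 hp.2
  have h1 := hf.comp (f := fun p : ℝ × E ↦ p.1 • p.2) (by fun_prop) hm
  have h2 := hΓ.comp (f := fun p : ℝ × E ↦ p.1 • p.2) (by fun_prop) hm
  exact h1.mul (h2.clm_apply continuousOn_snd)

theorem continuousOn_radialIntegrandDeriv {Γ : E → E →L[ℝ] A} {Γ' : E → E →L[ℝ] E →L[ℝ] A}
    {f : E → A} {f' : E → E →L[ℝ] A} {r : ℝ}
    (hf : ContinuousOn f (ball 0 r)) (hΓ : ContinuousOn Γ (ball 0 r))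
    (hf' : ContinuousOn f' (ball 0 r)) (hΓ' : ContinuousOn Γ' (ball 0 r)) :
    ContinuousOn (fun p : ℝ × E ↦ radialIntegrandDeriv Γ Γ' f f' p.1 p.2)
      (Icc 0 1 ×ˢ ball 0 r) := by
  have hm : MapsTo (fun p : ℝ × E ↦ p.1 • p.2) (Icc 0 1 ×ˢ ball 0 r) (ball 0 r) :=
    fun p hp ↦ smul_mem_ball_zero hp.1 hp.2
  have hc : ContinuousOn (fun p : ℝ × E ↦ p.1 • p.2) (Icc 0 1 ×ˢ ball (0 : E) r) := by fun_prop
  have h1 := hf.comp hc hm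
  have h2 := hΓ.comp hc hm
  have h3 := hf'.comp hc hm
  have h4 := hΓ'.comp hc hm
  refine ((continuousOn_const.clm_apply h1).clm_comp (h2.add (continuousOn_fst.smul ?_))).add
    (continuousOn_fst.smul ((continuousOn_const.clm_apply (h2.clm_apply continuousOn_snd)).clm_comp h3))
  exact (((ContinuousLinearMap.flipₗᵢ ℝ E E A).continuous.comp_continuousOn h4)).clm_apply
    continuousOn_snd

theorem norm_radialIntegrand_le {Γ : E → E →L[ℝ] A} {f : E → A} {t : ℝ} {x : E} {a C r : ℝ}
    (hf : ‖f (t • x)‖ ≤ a) (hΓ : ‖Γ (t • x)‖ ≤ C) (hx : ‖x‖ ≤ r) :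
    ‖radialIntegrand Γ f t x‖ ≤ a * (C * r) :=
  (norm_mul_le _ _).trans <| mul_le_mul hf ((Γ (t • x)).le_of_opNorm_le_of_le hΓ hx)
    (norm_nonneg _) ((norm_nonneg _).trans hf)

/-- The bound `b` on `f'` enters only with the factor `C * r`, which is at most `1 / 2` in the
application; the rest is a source term controlled by the bound on `f`. -/
theorem norm_radialIntegrandDeriv_le {Γ : E → E →L[ℝ] A} {Γ' : E → E →L[ℝ] E →L[ℝ] A}
    {f : E → A} {f' : E → E →L[ℝ] A} {t : ℝ} {x : E} {a b C r : ℝ} (ht : t ∈ Icc (0 : ℝ) 1)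
    (hf : ‖f (t • x)‖ ≤ a) (hf' : ‖f' (t • x)‖ ≤ b)
    (hΓ : ‖Γ (t • x)‖ ≤ C) (hΓ' : ‖Γ' (t • x)‖ ≤ C) (hx : ‖x‖ ≤ r) :
    ‖radialIntegrandDeriv Γ Γ' f f' t x‖ ≤ a * (C + C * r) + b * (C * r) := by
  have ha := (norm_nonneg _).trans hf
  have hb := (norm_nonneg _).trans hf'
  have hC := (norm_nonneg _).trans hΓ
  have hr := (norm_nonneg _).trans hx
  refine ContinuousLinearMap.opNorm_le_bound _ (by positivity) fun h ↦ ?_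
  rw [radialIntegrandDeriv_apply]
  have e1 : ‖Γ (t • x) h‖ ≤ C * ‖h‖ := (Γ (t • x)).le_of_opNorm_le hΓ h
  have e2 : ‖Γ' (t • x) h x‖ ≤ C * ‖h‖ * r :=
    ContinuousLinearMap.le_of_opNorm_le_of_le _ ((Γ' (t • x)).le_of_opNorm_le hΓ' h) hx
  have e3 : ‖Γ (t • x) x‖ ≤ C * r := ContinuousLinearMap.le_of_opNorm_le_of_le _ hΓ hx
  have e4 : ‖f' (t • x) h‖ ≤ b * ‖h‖ := ContinuousLinearMap.le_of_opNorm_le _ hf' h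
  have smul_le : ∀ y : A, ‖t • y‖ ≤ ‖y‖ := fun y ↦ by
    rw [norm_smul, Real.norm_of_nonneg ht.1]
    exact mul_le_of_le_one_left (norm_nonneg y) ht.2
  calc _ ≤ ‖f (t • x)‖ * (‖Γ (t • x) h‖ + ‖Γ' (t • x) h x‖) + ‖f' (t • x) h‖ * ‖Γ (t • x) x‖ := by
        refine (norm_add_le _ _).trans (add_le_add ?_ ((smul_le _).trans (norm_mul_le _ _)))
        exact (norm_mul_le _ _).trans (mul_le_mul_of_nonneg_left
          ((norm_add_le _ _).trans (add_le_add le_rfl (smul_le _))) (norm_nonneg _))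
    _ ≤ a * (C * ‖h‖ + C * ‖h‖ * r) + b * ‖h‖ * (C * r) := by gcongr
    _ = _ := by ring

/-- The iterates of the radial integral operator, starting from the constant function `1`. -/
noncomputable def radialIterate (Γ : E → E →L[ℝ] A) : ℕ → E → A
  | 0 => fun _ ↦ 1
  | n + 1 => fun x ↦ ∫ t in 0..1, radialIntegrand Γ (radialIterate Γ n) t x

/-- The derivatives of `radialIterate`. -/
noncomputable def radialIterateDeriv (Γ : E → E →L[ℝ] A) (Γ' : E → E →L[ℝ] E →L[ℝ] A) :
    ℕ → E → E →L[ℝ] A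
  | 0 => fun _ ↦ 0
  | n + 1 => fun x ↦
      ∫ t in 0..1, radialIntegrandDeriv Γ Γ' (radialIterate Γ n) (radialIterateDeriv Γ Γ' n) t x

/-- `Γ` is `C¹` on the ball of radius `r` with derivative `Γ'`, both are bounded by `C` there, and
`r` is so small that the radial integral operator is a contraction. -/
structure IsRadialBound (Γ : E → E →L[ℝ] A) (Γ' : E → E →L[ℝ] E →L[ℝ] A) (C r : ℝ) : Prop where
  pos : 0 < r
  le_one : r ≤ 1
  mul_le : C * r ≤ 1 / 2
  hasFDerivAt : ∀ x ∈ ball (0 : E) r, HasFDerivAt Γ (Γ' x) x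
  continuousOn : ContinuousOn Γ' (ball 0 r)
  norm_le : ∀ x ∈ ball (0 : E) r, ‖Γ x‖ ≤ C
  norm_deriv_le : ∀ x ∈ ball (0 : E) r, ‖Γ' x‖ ≤ C

variable {Γ : E → E →L[ℝ] A} {Γ' : E → E →L[ℝ] E →L[ℝ] A} {C r : ℝ}

namespace IsRadialBound

theorem nonneg (H : IsRadialBound Γ Γ' C r) : 0 ≤ C :=
  (norm_nonneg _).trans (H.norm_le 0 (mem_ball_self H.pos))

theorem continuousOn_form (H : IsRadialBound Γ Γ' C r) : ContinuousOn Γ (ball 0 r) :=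
  fun x hx ↦ (H.hasFDerivAt x hx).continuousAt.continuousWithinAt

theorem hasFDerivAt_integral (H : IsRadialBound Γ Γ' C r) {f : E → A} {f' : E → E →L[ℝ] A} {a b : ℝ}
    (hd : ∀ x ∈ ball (0 : E) r, HasFDerivAt f (f' x) x) (hc : ContinuousOn f' (ball 0 r))
    (ha : ∀ x ∈ ball (0 : E) r, ‖f x‖ ≤ a) (hb : ∀ x ∈ ball (0 : E) r, ‖f' x‖ ≤ b)
    {s : ℝ} (hs : s ∈ Icc (0 : ℝ) 1) {x : E} (hx : x ∈ ball (0 : E) r) :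
    HasFDerivAt (fun x ↦ ∫ t in 0..s, radialIntegrand Γ f t x)
      (∫ t in 0..s, radialIntegrandDeriv Γ Γ' f f' t x) x := by
  have hf : ContinuousOn f (ball 0 r) := fun x hx ↦ (hd x hx).continuousAt.continuousWithinAt
  refine hasFDerivAt_integral_param isOpen_ball (continuousOn_radialIntegrand hf H.continuousOn_form)
    (continuousOn_radialIntegrandDeriv hf H.continuousOn_form hc H.continuousOn)
    (C := a * (C + C * r) + b * (C * r)) ?_ ?_ hs hx
  · intro t ht y hy
    have hy' := smul_mem_ball_zero ht hy
    exact norm_radialIntegrandDeriv_le ht (ha _ hy') (hb _ hy') (H.norm_le _ hy')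
      (H.norm_deriv_le _ hy') (mem_ball_zero_iff.1 hy).le
  · intro t ht y hy
    have hy' := smul_mem_ball_zero ht hy
    exact hasFDerivAt_radialIntegrand (hd _ hy') (H.hasFDerivAt _ hy')

/-- Each integration costs a factor `C * r ≤ 1 / 2`. The derivative bounds obey `b (n + 1) = 2 * C *
(1 / 2) ^ n + b n / 2` with `b 0 = 0`, solved by `4 * C * n * (1 / 2) ^ n`, which is still summable.
-/
theorem iterate_spec (H : IsRadialBound Γ Γ' C r) (h1 : ‖(1 : A)‖ ≤ 1) (n : ℕ) :
    (∀ x ∈ ball (0 : E) r, HasFDerivAt (radialIterate Γ n) (radialIterateDeriv Γ Γ' n x) x) ∧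
    ContinuousOn (radialIterateDeriv Γ Γ' n) (ball 0 r) ∧
    (∀ x ∈ ball (0 : E) r, ‖radialIterate Γ n x‖ ≤ (1 / 2) ^ n) ∧
    (∀ x ∈ ball (0 : E) r, ‖radialIterateDeriv Γ Γ' n x‖ ≤ 4 * C * (n * (1 / 2) ^ n)) := by
  have hC := H.nonneg
  induction n with
  | zero =>
    refine ⟨fun x _ ↦ hasFDerivAt_const _ _, continuousOn_const, fun x _ ↦ ?_, fun x _ ↦ ?_⟩ <;>
    simp [radialIterate, radialIterateDeriv, h1]
  | succ n ih =>
    obtain ⟨hd, hc, ha, hb⟩ := ih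
    have hf : ContinuousOn (radialIterate Γ n) (ball 0 r) :=
      fun x hx ↦ (hd x hx).continuousAt.continuousWithinAt
    have hbound : ∀ t ∈ Icc (0 : ℝ) 1, ∀ x ∈ ball (0 : E) r,
        ‖radialIntegrandDeriv Γ Γ' (radialIterate Γ n) (radialIterateDeriv Γ Γ' n) t x‖ ≤
          4 * C * ((n + 1 : ℕ) * (1 / 2) ^ (n + 1)) := by
      intro t ht x hx
      have hx' := smul_mem_ball_zero ht hx
      refine (norm_radialIntegrandDeriv_le ht (ha _ hx') (hb _ hx') (H.norm_le _ hx')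
        (H.norm_deriv_le _ hx') (mem_ball_zero_iff.1 hx).le).trans ?_
      have h1 : C * r ≤ C := mul_le_of_le_one_right hC H.le_one
      calc _ ≤ (1 / 2 : ℝ) ^ n * (C + C) + 4 * C * (n * (1 / 2) ^ n) * (1 / 2) := by
            gcongr; exact H.mul_le
        _ = _ := by push_cast; ring
    refine ⟨fun x hx ↦ H.hasFDerivAt_integral hd hc ha hb (by simp) hx, ?_, fun x hx ↦ ?_,
      fun x hx ↦ ?_⟩
    · exact continuousOn_integral_param isOpen_ball
        (continuousOn_radialIntegrandDeriv hf H.continuousOn_form hc H.continuousOn) hbound (by simp)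
    · have : ∀ t ∈ Ι (0 : ℝ) 1,
          ‖radialIntegrand Γ (radialIterate Γ n) t x‖ ≤ (1 / 2) ^ n * (C * r) := by
        intro t ht
        rw [uIoc_of_le zero_le_one] at ht
        have hx' := smul_mem_ball_zero ⟨ht.1.le, ht.2⟩ hx
        exact norm_radialIntegrand_le (ha _ hx') (H.norm_le _ hx') (mem_ball_zero_iff.1 hx).le
      refine (intervalIntegral.norm_integral_le_of_norm_le_const this).trans ?_
      calc _ ≤ (1 / 2 : ℝ) ^ n * (1 / 2) * |1 - 0| := by gcongr; exact H.mul_le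
        _ = _ := by norm_num [pow_succ]
    · refine (intervalIntegral.norm_integral_le_of_norm_le_const
        (C := 4 * C * ((n + 1 : ℕ) * (1 / 2) ^ (n + 1))) fun t ht ↦ ?_).trans (by simp)
      rw [uIoc_of_le zero_le_one] at ht
      exact hbound t ⟨ht.1.le, ht.2⟩ x hx

theorem radialIterate_radial (H : IsRadialBound Γ Γ' C r) [CompleteSpace A] (h1 : ‖(1 : A)‖ ≤ 1)
    (n : ℕ) {x : E} (hx : x ∈ ball (0 : E) r) :
    radialIterateDeriv Γ Γ' (n + 1) x x = radialIterate Γ n x * Γ x x := by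
  have hd : HasDerivAt (fun s : ℝ ↦ radialIterate Γ (n + 1) (s • x))
      (radialIterateDeriv Γ Γ' (n + 1) x x) 1 := by
    have h2 : HasDerivAt (fun s : ℝ ↦ s • x) ((1 : ℝ) • x) 1 := (hasDerivAt_id (1 : ℝ)).smul_const x
    have h3 := (H.iterate_spec h1 (n + 1)).1 x hx
    rw [← one_smul ℝ x] at h3
    simpa [Function.comp_def] using! h3.comp_hasDerivAt (1 : ℝ) h2
  -- Rescaling the integration variable moves `s` into the upper limit, so the radial derivative is
  -- given by the fundamental theorem of calculus.
  have he : ∀ s : ℝ, radialIterate Γ (n + 1) (s • x) =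
      ∫ t in 0..s, radialIntegrand Γ (radialIterate Γ n) t x := by
    intro s
    have := intervalIntegral.smul_integral_comp_mul_right (a := 0) (b := 1)
      (fun t ↦ radialIntegrand Γ (radialIterate Γ n) t x) s
    rw [zero_mul, one_mul] at this
    rw [← this, ← intervalIntegral.integral_smul]
    simp [radialIterate, radialIntegrand, smul_smul]
  have hf : ContinuousOn (radialIterate Γ n) (ball 0 r) :=
    fun x hx ↦ ((H.iterate_spec h1 n).1 x hx).continuousAt.continuousWithinAt
  have hU : IsOpen ((fun t : ℝ ↦ t • x) ⁻¹' ball 0 r) := isOpen_ball.preimage (by fun_prop)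
  have hc : ContinuousOn (fun t ↦ radialIntegrand Γ (radialIterate Γ n) t x)
      ((fun t : ℝ ↦ t • x) ⁻¹' ball 0 r) := by
    have hs : ContinuousOn (fun t : ℝ ↦ t • x) ((fun t : ℝ ↦ t • x) ⁻¹' ball 0 r) := by fun_prop
    exact (hf.comp hs fun t ht ↦ ht).mul
      ((H.continuousOn_form.comp hs fun t ht ↦ ht).clm_apply continuousOn_const)
  have h1mem : (1 : ℝ) ∈ (fun t : ℝ ↦ t • x) ⁻¹' ball 0 r := by simpa using hx
  have hi := intervalIntegral.integral_hasDerivAt_right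
    (intervalIntegrable_of_continuousOn_Icc_prod
      (continuousOn_radialIntegrand hf H.continuousOn_form) (by simp) hx)
    (hc.stronglyMeasurableAtFilter hU 1 h1mem) (hc.continuousAt (hU.mem_nhds h1mem))
  rw [← funext he] at hi
  simpa [radialIntegrand] using hd.unique hi

/-- The radial transport equation `α'(x)(x) = α(x) Γ(x)(x)` has a `C¹` solution near the origin. -/
theorem exists_radial_solution (H : IsRadialBound Γ Γ' C r) [CompleteSpace A]
    (h1 : ‖(1 : A)‖ ≤ 1) :
    ∃ (α : E → A) (α' : E → E →L[ℝ] A) (a b : ℝ), α 0 = 1 ∧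
      (∀ x ∈ ball (0 : E) r, HasFDerivAt α (α' x) x) ∧ ContinuousOn α' (ball 0 r) ∧
      (∀ x ∈ ball (0 : E) r, ‖α x‖ ≤ a) ∧ (∀ x ∈ ball (0 : E) r, ‖α' x‖ ≤ b) ∧
      ∀ x ∈ ball (0 : E) r, α' x x = α x * Γ x x := by
  have hsum : Summable fun n : ℕ ↦ ((1 / 2 : ℝ)) ^ n := summable_geometric_two
  have hsum' : Summable fun n : ℕ ↦ 4 * C * (n * (1 / 2 : ℝ) ^ n) := by
    have := summable_pow_mul_geometric_of_norm_lt_one (R := ℝ) 1 (r := 1 / 2) (by norm_num)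
    simpa using this.mul_left (4 * C)
  have hsB : ∀ x ∈ ball (0 : E) r, Summable fun n ↦ radialIterate Γ n x := fun x hx ↦
    .of_norm_bounded hsum fun n ↦ (H.iterate_spec h1 n).2.2.1 x hx
  have hsB' : ∀ x ∈ ball (0 : E) r, Summable fun n ↦ radialIterateDeriv Γ Γ' n x := fun x hx ↦
    .of_norm_bounded hsum' fun n ↦ (H.iterate_spec h1 n).2.2.2 x hx
  have h0 : (0 : E) ∈ ball (0 : E) r := mem_ball_self H.pos
  refine ⟨fun x ↦ ∑' n, radialIterate Γ n x, fun x ↦ ∑' n, radialIterateDeriv Γ Γ' n x, _, _,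
    ?_, fun x hx ↦ ?_, ?_, fun x hx ↦ tsum_of_norm_bounded hsum.hasSum
      fun n ↦ (H.iterate_spec h1 n).2.2.1 x hx, fun x hx ↦ tsum_of_norm_bounded hsum'.hasSum
      fun n ↦ (H.iterate_spec h1 n).2.2.2 x hx, fun x hx ↦ ?_⟩
  -- Every later iterate vanishes at the origin, its integrand being evaluated on the zero vector.
  · dsimp only
    rw [tsum_eq_single 0]
    · rfl
    · rintro (_ | n) hn
      · exact (hn rfl).elim
      · simp [radialIterate, radialIntegrand]
  · exact hasFDerivAt_tsum_of_isPreconnected hsum' isOpen_ball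
      (convex_ball (0 : E) r).isPreconnected (fun n ↦ (H.iterate_spec h1 n).1)
      (fun n ↦ (H.iterate_spec h1 n).2.2.2) h0 (hsB 0 h0) hx
  · exact continuousOn_tsum (fun n ↦ (H.iterate_spec h1 n).2.1) hsum'
      fun n ↦ (H.iterate_spec h1 n).2.2.2
  · dsimp only
    have e : (∑' n, radialIterateDeriv Γ Γ' n x) x = ∑' n, radialIterateDeriv Γ Γ' n x x :=
      (ContinuousLinearMap.apply ℝ A x).map_tsum (hsB' x hx)
    have hs : Summable fun n ↦ radialIterateDeriv Γ Γ' n x x :=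
      (hsB' x hx).mapL (ContinuousLinearMap.apply ℝ A x)
    -- The zeroth derivative is zero; after the index shift the series telescopes through
    -- `radialIterate_radial`.
    rw [e, hs.tsum_eq_zero_add, ← (hsB x hx).tsum_mul_right]
    simp only [radialIterate_radial H h1 _ hx]
    simp [radialIterateDeriv]

theorem hasDerivAt_comp_smul_line {α : E → A} {α' : E → E →L[ℝ] A}
    (hd : ∀ x ∈ ball (0 : E) r, HasFDerivAt α (α' x) x) {y : E} {s : ℝ}
    (hy : s • y ∈ ball (0 : E) r) : HasDerivAt (fun s : ℝ ↦ α (s • y)) (α' (s • y) y) s := by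
  have h2 : HasDerivAt (fun s : ℝ ↦ s • y) ((1 : ℝ) • y) s := (hasDerivAt_id s).smul_const y
  simpa [Function.comp_def] using! (hd _ hy).comp_hasDerivAt s h2

/-- The radial equation at `s • y` carries a factor `s` on both sides. It can be cancelled for `s ≠
0`, and the case `s = 0` follows by continuity. -/
theorem radial_eq_of_smul_mem (H : IsRadialBound Γ Γ' C r)
    {α : E → A} {α' : E → E →L[ℝ] A}
    (hf : ContinuousOn α (ball 0 r)) (hc : ContinuousOn α' (ball 0 r))
    (hrad : ∀ x ∈ ball (0 : E) r, α' x x = α x * Γ x x)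
    {y : E} {s : ℝ} (hy : s • y ∈ ball (0 : E) r) :
    α' (s • y) y = α (s • y) * Γ (s • y) y := by
  have hne : ∀ s : ℝ, s • y ∈ ball (0 : E) r → s ≠ 0 →
      α' (s • y) y = α (s • y) * Γ (s • y) y := by
    intro s hy hs
    have := hrad _ hy
    rw [map_smul, map_smul, mul_smul_comm] at this
    exact smul_right_injective _ hs this
  rcases eq_or_ne s 0 with rfl | hs
  · have hU : IsOpen ((fun t : ℝ ↦ t • y) ⁻¹' ball 0 r) := isOpen_ball.preimage (by fun_prop)
    have hy0 : (0 : ℝ) ∈ (fun t : ℝ ↦ t • y) ⁻¹' ball 0 r := hy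
    have hs : ContinuousOn (fun t : ℝ ↦ t • y) ((fun t : ℝ ↦ t • y) ⁻¹' ball 0 r) := by fun_prop
    have c1 := (((hc.comp hs fun t ht ↦ ht).clm_apply
      (continuousOn_const (c := y))).continuousAt (hU.mem_nhds hy0)).tendsto
    have c2 := (((hf.comp hs fun t ht ↦ ht).mul ((H.continuousOn_form.comp hs
      fun t ht ↦ ht).clm_apply (continuousOn_const (c := y)))).continuousAt
      (hU.mem_nhds hy0)).tendsto
    refine tendsto_nhds_unique (c1.mono_left nhdsWithin_le_nhds)
      ((c2.mono_left (nhdsWithin_le_nhds (s := {(0 : ℝ)}ᶜ))).congr' ?_)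
    filter_upwards [nhdsWithin_le_nhds (hU.mem_nhds hy0), self_mem_nhdsWithin] with t ht ht0
    exact (hne t ht ht0).symm
  · exact hne s hy hs

/-- Obtained by differentiating the integrated radial equation in `x`. As `α` is only `C¹`, this is
what makes `s • α' (s • x) h` differentiable in `s`. -/
theorem smul_deriv_eq_integral (H : IsRadialBound Γ Γ' C r) [CompleteSpace A]
    {α : E → A} {α' : E → E →L[ℝ] A} {a b : ℝ}
    (hd : ∀ x ∈ ball (0 : E) r, HasFDerivAt α (α' x) x) (hc : ContinuousOn α' (ball 0 r))
    (ha : ∀ x ∈ ball (0 : E) r, ‖α x‖ ≤ a) (hb : ∀ x ∈ ball (0 : E) r, ‖α' x‖ ≤ b)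
    (hrad : ∀ x ∈ ball (0 : E) r, α' x x = α x * Γ x x)
    {x : E} (hx : x ∈ ball (0 : E) r) (h : E) {s : ℝ} (hs : s ∈ Icc (0 : ℝ) 1) :
    s • α' (s • x) h = ∫ t in 0..s, radialIntegrandDeriv Γ Γ' α α' t x h := by
  have hf : ContinuousOn α (ball 0 r) := fun x hx ↦ (hd x hx).continuousAt.continuousWithinAt
  have hcI := continuousOn_radialIntegrand hf H.continuousOn_form
  have hcD := continuousOn_radialIntegrandDeriv hf H.continuousOn_form hc H.continuousOn
  have hint : ∀ y ∈ ball (0 : E) r,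
      α (s • y) = α 0 + ∫ t in 0..s, radialIntegrand Γ α t y := by
    intro y hy
    have := intervalIntegral.integral_eq_sub_of_hasDerivAt (a := 0) (b := s)
      (f := fun s : ℝ ↦ α (s • y)) (f' := fun t ↦ radialIntegrand Γ α t y) (fun t ht ↦ ?_)
      (intervalIntegrable_of_continuousOn_Icc_prod hcI hs hy)
    · rw [this]; simp
    · rw [uIcc_of_le hs.1] at ht
      have hy' := smul_mem_ball_zero ⟨ht.1, ht.2.trans hs.2⟩ hy
      rw [radialIntegrand, ← radial_eq_of_smul_mem H hf hc hrad hy']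
      exact hasDerivAt_comp_smul_line hd hy'
  have e1 : HasFDerivAt (fun y ↦ α (s • y)) ((α' (s • x)).comp (s • ContinuousLinearMap.id ℝ E)) x :=
    (hd _ (smul_mem_ball_zero hs hx)).comp x ((hasFDerivAt_id x).const_smul s)
  have e2 := (H.hasFDerivAt_integral hd hc ha hb hs hx).const_add (α 0)
  have e3 := e2.congr_of_eventuallyEq (f₁ := fun y ↦ α (s • y)) (by
    filter_upwards [isOpen_ball.mem_nhds hx] with y hy using hint y hy)
  have e4 := DFunLike.congr_fun (e1.unique e3) h
  rw [ContinuousLinearMap.intervalIntegral_apply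
    (intervalIntegrable_of_continuousOn_Icc_prod hcD hs hx)] at e4
  simpa using e4

/-- Here `ghx` stands for `Γ' h x` and `gxh` for `Γ' x h`. The left side is the `s`-derivative of
the defect `s • (α' h - α * Γ h)`; flatness exchanges the two mixed derivatives. -/
theorem transport_defect_algebra {R : Type*} [Ring R] [Algebra ℝ R] {s : ℝ}
    {a a'h a'x gh gx ghx gxh : R}
    (hflat : ghx + gh * gx = gxh + gx * gh) (hrad : a'x = a * gx) :
    a * (gh + s • ghx) + s • (a'h * gx) - (s • (a'x * gh + a * gxh) + (1 : ℝ) • (a * gh)) =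
      (s • a'h - s • (a * gh)) * gx := by
  have : ghx = gxh + gx * gh - gh * gx := by rw [← hflat]; abel
  subst hrad this
  simp only [one_smul, sub_mul, smul_mul_assoc, mul_add, mul_sub, mul_smul_comm, mul_assoc,
    smul_add, smul_sub]
  abel

theorem hasDerivWithinAt_transport_defect (H : IsRadialBound Γ Γ' C r) [CompleteSpace A]
    (hflat : ∀ x ∈ ball (0 : E) r, ∀ u v : E,
      Γ' x u v + Γ x u * Γ x v = Γ' x v u + Γ x v * Γ x u)
    {α : E → A} {α' : E → E →L[ℝ] A} {a b : ℝ}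
    (hd : ∀ x ∈ ball (0 : E) r, HasFDerivAt α (α' x) x) (hc : ContinuousOn α' (ball 0 r))
    (ha : ∀ x ∈ ball (0 : E) r, ‖α x‖ ≤ a) (hb : ∀ x ∈ ball (0 : E) r, ‖α' x‖ ≤ b)
    (hrad : ∀ x ∈ ball (0 : E) r, α' x x = α x * Γ x x)
    {x : E} (hx : x ∈ ball (0 : E) r) (h : E) {s : ℝ} (hs : s ∈ Ico (0 : ℝ) 1) :
    HasDerivWithinAt (fun s : ℝ ↦ s • α' (s • x) h - s • (α (s • x) * Γ (s • x) h))
      ((s • α' (s • x) h - s • (α (s • x) * Γ (s • x) h)) * Γ (s • x) x) (Ici s) s := by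
  have hf : ContinuousOn α (ball 0 r) := fun x hx ↦ (hd x hx).continuousAt.continuousWithinAt
  have hcD := continuousOn_radialIntegrandDeriv hf H.continuousOn_form hc H.continuousOn
  have hs' : s ∈ Icc (0 : ℝ) 1 := Ico_subset_Icc_self hs
  have hsx := smul_mem_ball_zero hs' hx
  have hTc : ContinuousOn (fun t ↦ radialIntegrandDeriv Γ Γ' α α' t x h) (Icc 0 1) :=
    (hcD.comp (f := fun t : ℝ ↦ (t, x)) (by fun_prop) fun t ht ↦ ⟨ht, hx⟩).clm_apply
      continuousOn_const
  have hnhds : Icc (0 : ℝ) 1 ∈ 𝓝[≥] s :=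
    mem_of_superset (Ico_mem_nhdsGE hs.2) fun t ht ↦ ⟨hs.1.trans ht.1, ht.2.le⟩
  have d1 : HasDerivWithinAt (fun s ↦ s • α' (s • x) h)
      (radialIntegrandDeriv Γ Γ' α α' s x h) (Ici s) s := by
    have : HasDerivWithinAt (fun u ↦ ∫ t in 0..u, radialIntegrandDeriv Γ Γ' α α' t x h)
        (radialIntegrandDeriv Γ Γ' α α' s x h) (Ici s) s := by
      refine intervalIntegral.integral_hasDerivWithinAt_right (t := Ioi s) ?_ ?_ ?_
      · exact (hTc.mono (by
          rw [uIcc_of_le hs.1]; exact Icc_subset_Icc_right hs.2.le)).intervalIntegrable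
      · exact ⟨Icc 0 1, nhdsWithin_mono _ Ioi_subset_Ici_self hnhds,
          hTc.aestronglyMeasurable measurableSet_Icc⟩
      · exact ((hTc s hs').mono_of_mem_nhdsWithin hnhds).mono Ioi_subset_Ici_self
    refine this.congr_of_eventuallyEq ?_ (smul_deriv_eq_integral H hd hc ha hb hrad hx h hs')
    filter_upwards [hnhds] with t ht using smul_deriv_eq_integral H hd hc ha hb hrad hx h ht
  have hsm : HasDerivAt (fun s : ℝ ↦ s • x) x s := by
    simpa using (hasDerivAt_id s).smul_const x
  have d2 : HasDerivAt (fun s : ℝ ↦ Γ (s • x) h) (Γ' (s • x) x h) s := by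
    have h1 : HasDerivAt (fun s : ℝ ↦ Γ (s • x)) (Γ' (s • x) x) s :=
      (H.hasFDerivAt _ hsx).comp_hasDerivAt s hsm
    exact ((ContinuousLinearMap.apply ℝ A h).hasFDerivAt (x := Γ (s • x))).comp_hasDerivAt s h1
  have d4 : HasDerivAt (fun s : ℝ ↦ α (s • x) * Γ (s • x) h)
      (α' (s • x) x * Γ (s • x) h + α (s • x) * Γ' (s • x) x h) s :=
    HasDerivAt.fun_mul (hasDerivAt_comp_smul_line hd hsx) d2
  have d3 : HasDerivAt (fun s : ℝ ↦ s • (α (s • x) * Γ (s • x) h))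
      (s • (α' (s • x) x * Γ (s • x) h + α (s • x) * Γ' (s • x) x h) +
        (1 : ℝ) • (α (s • x) * Γ (s • x) h)) s :=
    HasDerivAt.fun_smul (hasDerivAt_id' s) d4
  refine (d1.sub d3.hasDerivWithinAt).congr_deriv ?_
  rw [radialIntegrandDeriv_apply]
  exact transport_defect_algebra (hflat _ hsx h x) (radial_eq_of_smul_mem H hf hc hrad hsx)

/-- If `Γ` is flat, then a radial solution solves the transport equation in all directions. -/
theorem transport_of_radial (H : IsRadialBound Γ Γ' C r) [CompleteSpace A]
    (hflat : ∀ x ∈ ball (0 : E) r, ∀ u v : E,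
      Γ' x u v + Γ x u * Γ x v = Γ' x v u + Γ x v * Γ x u)
    {α : E → A} {α' : E → E →L[ℝ] A} {a b : ℝ}
    (hd : ∀ x ∈ ball (0 : E) r, HasFDerivAt α (α' x) x) (hc : ContinuousOn α' (ball 0 r))
    (ha : ∀ x ∈ ball (0 : E) r, ‖α x‖ ≤ a) (hb : ∀ x ∈ ball (0 : E) r, ‖α' x‖ ≤ b)
    (hrad : ∀ x ∈ ball (0 : E) r, α' x x = α x * Γ x x)
    {x : E} (hx : x ∈ ball (0 : E) r) (h : E) : α' x h = α x * Γ x h := by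
  have hf : ContinuousOn α (ball 0 r) := fun x hx ↦ (hd x hx).continuousAt.continuousWithinAt
  have hRc : ContinuousOn (fun s : ℝ ↦ s • α' (s • x) h - s • (α (s • x) * Γ (s • x) h))
      (Icc 0 1) := by
    have hs : ContinuousOn (fun t : ℝ ↦ t • x) (Icc 0 1) := by fun_prop
    have hm : MapsTo (fun t : ℝ ↦ t • x) (Icc 0 1) (ball 0 r) :=
      fun t ht ↦ smul_mem_ball_zero ht hx
    exact (continuousOn_id.smul ((hc.comp hs hm).clm_apply continuousOn_const)).sub
      (continuousOn_id.smul ((hf.comp hs hm).mul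
        ((H.continuousOn_form.comp hs hm).clm_apply continuousOn_const)))
  -- Grönwall: the defect solves a linear equation with coefficient bounded by `C * r`, and its
  -- factor `s` makes it vanish at `s = 0`. The conclusion is read off at `s = 1`.
  have hR0 := eq_zero_of_abs_deriv_le_mul_abs_self_of_eq_zero_right (K := C * r) hRc
    (fun s hs ↦ hasDerivWithinAt_transport_defect H hflat hd hc ha hb hrad hx h hs)
    (by simp) (fun s hs ↦ by
      rw [mul_comm]
      have hsx := smul_mem_ball_zero (Ico_subset_Icc_self hs) hx
      refine (norm_mul_le _ _).trans (mul_le_mul_of_nonneg_left ?_ (norm_nonneg _))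
      exact ContinuousLinearMap.le_of_opNorm_le_of_le _ (H.norm_le _ hsx)
        (mem_ball_zero_iff.1 hx).le) 1 (by simp)
  simpa [sub_eq_zero] using hR0

end IsRadialBound

/-- A flat `C¹` connection form is locally the logarithmic derivative of a gauge transformation. -/
theorem exists_transport_of_flat [CompleteSpace A] (h1 : ‖(1 : A)‖ ≤ 1) {U : Set E} (hU : IsOpen U)
    {y₀ : E} (hy₀ : y₀ ∈ U) (hΓ : ContDiffOn ℝ 1 Γ U)
    (hflat : ∀ x ∈ U, ∀ u v : E,
      fderiv ℝ Γ x u v + Γ x u * Γ x v = fderiv ℝ Γ x v u + Γ x v * Γ x u) :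
    ∃ r > 0, ball y₀ r ⊆ U ∧ ∃ α : E → A, α y₀ = 1 ∧ ∀ y ∈ ball y₀ r,
      HasFDerivAt α ((ContinuousLinearMap.mul ℝ A (α y)).comp (Γ y)) y := by
  have hd : DifferentiableOn ℝ Γ U := hΓ.differentiableOn one_ne_zero
  have hc : ContinuousOn (fderiv ℝ Γ) U := hΓ.continuousOn_fderiv_of_isOpen hU le_rfl
  obtain ⟨C, hC1, hC2⟩ : ∃ C : ℝ, ‖Γ y₀‖ < C ∧ ‖fderiv ℝ Γ y₀‖ < C :=
    ⟨max ‖Γ y₀‖ ‖fderiv ℝ Γ y₀‖ + 1, by linarith [le_max_left ‖Γ y₀‖ ‖fderiv ℝ Γ y₀‖],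
      by linarith [le_max_right ‖Γ y₀‖ ‖fderiv ℝ Γ y₀‖]⟩
  have hCpos : 0 < C := (norm_nonneg _).trans_lt hC1
  have hn : Tendsto (fun y ↦ ‖fderiv ℝ Γ y‖) (𝓝 y₀) (𝓝 ‖fderiv ℝ Γ y₀‖) :=
    ((continuous_norm (E := E →L[ℝ] E →L[ℝ] A)).tendsto _).comp (hc.continuousAt (hU.mem_nhds hy₀))
  have hnh : ∀ᶠ y in 𝓝 y₀, y ∈ U ∧ ‖Γ y‖ < C ∧ ‖fderiv ℝ Γ y‖ < C :=
    (show ∀ᶠ y in 𝓝 y₀, y ∈ U from hU.mem_nhds hy₀).and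
      ((((hd.continuousOn.continuousAt (hU.mem_nhds hy₀)).norm).eventually_lt_const hC1).and
      (hn.eventually_lt_const hC2))
  obtain ⟨ρ, hρ, hρU⟩ := Metric.eventually_nhds_iff_ball.1 hnh
  -- `ρ` keeps the bounds by `C` valid, and `1 / (2 * C)` gives the contraction factor `1 / 2`.
  set r := min ρ (min 1 (1 / (2 * C))) with hr
  have hrpos : 0 < r := by positivity
  have hsub : ∀ x ∈ ball (0 : E) r, y₀ + x ∈ ball y₀ ρ := fun x hx ↦ by
    rw [mem_ball_iff_norm, add_sub_cancel_left]
    exact (mem_ball_zero_iff.1 hx).trans_le (min_le_left _ _)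
  have hadd : ∀ x : E, HasFDerivAt (fun x ↦ y₀ + x) (ContinuousLinearMap.id ℝ E) x :=
    fun x ↦ (hasFDerivAt_id x).const_add y₀
  have H : IsRadialBound (fun x ↦ Γ (y₀ + x)) (fun x ↦ fderiv ℝ Γ (y₀ + x)) C r :=
    { pos := hrpos
      le_one := (min_le_right _ _).trans (min_le_left _ _)
      mul_le := by
        calc C * r ≤ C * (1 / (2 * C)) := by
              gcongr; exact (min_le_right _ _).trans (min_le_right _ _)
          _ = 1 / 2 := by field_simp
      hasFDerivAt := fun x hx ↦ by
        have := ((hd.differentiableAt (hU.mem_nhds (hρU _ (hsub x hx)).1)).hasFDerivAt).comp x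
          (hadd x)
        simpa [Function.comp_def] using! this
      continuousOn := hc.comp (by fun_prop) fun x hx ↦ (hρU _ (hsub x hx)).1
      norm_le := fun x hx ↦ (hρU _ (hsub x hx)).2.1.le
      norm_deriv_le := fun x hx ↦ (hρU _ (hsub x hx)).2.2.le }
  obtain ⟨α, α', a, b, h0, hα, hα', ha, hb, hrad⟩ := H.exists_radial_solution h1
  refine ⟨r, hrpos, fun y hy ↦ (hρU y (ball_subset_ball (min_le_left _ _) hy)).1,
    fun y ↦ α (y - y₀), by simpa using h0, fun y hy ↦ ?_⟩
  have hy' : y - y₀ ∈ ball (0 : E) r := by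
    rwa [mem_ball_zero_iff, ← mem_ball_iff_norm]
  have key := H.transport_of_radial (fun x hx u v ↦ hflat _ (hρU _ (hsub x hx)).1 u v)
    hα hα' ha hb hrad hy'
  have := (hα _ hy').comp y ((hasFDerivAt_id y).sub_const y₀)
  refine this.congr_fderiv ?_
  ext h
  simpa using key h

end RadialTransport

/-! ### Locally constant cocycles on a simply connected space. -/

section Cocycle

open Set Filter Topology

variable {M : Type*} [TopologicalSpace M] {ι : Type*} {G : Type*} [Group G]

/-- On a simply connected space, a locally constant cocycle is a coboundary. -/
theorem exists_coboundary_of_locallyConstant_cocycle [SimplyConnectedSpace M]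
    [LocallyPathConnectedSpace M] (U : ι → Set M) (hU : ∀ i, IsOpen (U i))
    (hcover : ∀ x, ∃ i, x ∈ U i) (g : ι → ι → M → G)
    (hg : ∀ i j, ∀ x ∈ U i ∩ U j, ∀ᶠ y in 𝓝 x, g i j y = g i j x)
    (hself : ∀ i, ∀ x ∈ U i, g i i x = 1)
    (hcomp : ∀ i j k, ∀ x ∈ U i ∩ U j ∩ U k, g i j x * g j k x = g i k x) :
    ∃ h : ι → M → G, (∀ i, ∀ x ∈ U i, ∀ᶠ y in 𝓝 x, h i y = h i x) ∧
      ∀ i j, ∀ x ∈ U i ∩ U j, h i x * g i j x = h j x := by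
  -- With a discrete fibre, the bundle glued by right multiplication with `g i j` is a covering of
  -- `M`.
  let _ : TopologicalSpace G := ⊥
  have : DiscreteTopology G := ⟨rfl⟩
  choose i₀ hi₀ using hcover
  let Z : FiberBundleCore ι M G :=
    { baseSet := U
      isOpen_baseSet := hU
      indexAt := i₀
      mem_baseSet_at := hi₀
      coordChange := fun i j x v ↦ v * g i j x
      coordChange_self := fun i x hx v ↦ by rw [hself i x hx, mul_one]
      continuousOn_coordChange := fun i j ↦ by
        rintro ⟨x, v⟩ ⟨hx, -⟩
        refine ContinuousAt.continuousWithinAt ?_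
        refine (continuousAt_const (y := v * g i j x)).congr ?_
        rw [nhds_prod_eq, nhds_discrete G]
        have h1 : ∀ᶠ w in pure v, w = v := by simp
        filter_upwards [(hg i j x hx).prod_mk h1] with p hp
        rw [hp.1, hp.2]
      coordChange_comp := fun i j k x hx v ↦ by rw [mul_assoc, hcomp i j k x hx] }
  have hcov : IsCoveringMap Z.proj := FiberBundle.isCoveringMap (F := G) (E := Z.Fiber)
  obtain ⟨x₀⟩ : Nonempty M := inferInstance
  -- Simple connectedness lifts the identity of `M` to a global section; `h i` is this section read
  -- in the `i`-th trivialization, hence locally constant.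
  obtain ⟨s, ⟨-, hs⟩, -⟩ := hcov.existsUnique_continuousMap_lifts (ContinuousMap.id M) x₀
    (⟨x₀, (1 : G)⟩ : Z.TotalSpace) rfl
  have hs' : ∀ x, (s x).1 = x := fun x ↦ congrFun hs x
  refine ⟨fun i x ↦ (Z.localTriv i (s x)).2, fun i x hx ↦ ?_, fun i j x hx ↦ ?_⟩
  · have hc : ContinuousAt (fun x ↦ (Z.localTriv i (s x)).2) x := by
      refine continuous_snd.continuousAt.comp (ContinuousAt.comp ?_ s.continuous.continuousAt)
      refine (Z.localTriv i).continuousAt ?_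
      rw [Z.mem_localTriv_source, hs' x]
      exact hx
    have := hc.tendsto
    rw [nhds_discrete G, tendsto_pure] at this
    exact this
  · have key : ∀ p : Z.TotalSpace, p.1 = x → (Z.localTriv i p).2 * g i j x = (Z.localTriv j p).2 := by
      rintro ⟨y, v : G⟩ rfl
      change v * g (i₀ y) i y * g i j y = v * g (i₀ y) j y
      rw [mul_assoc, hcomp _ i j y ⟨⟨hi₀ y, hx.1⟩, hx.2⟩]
    exact key (s x) (hs' x)

end Cocycle

/-! ### Smooth forms and dual frames. -/

section ManifoldCalculus

open Set Filter Topology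

variable {E : Type*} [NormedAddCommGroup E] [NormedSpace ℝ E]
  {M : Type*} [TopologicalSpace M] [ChartedSpace E M]
  {V : Type*} [NormedAddCommGroup V] [NormedSpace ℝ V]

/-- For finite-dimensional `F`, a basis identifies `F →L[ℝ] V` with a finite power of `V`, where
smoothness is componentwise. -/
theorem contMDiffAt_clm_of_apply {F : Type*} [NormedAddCommGroup F] [NormedSpace ℝ F]
    [FiniteDimensional ℝ F] {n : ℕ∞ω} {f : M → F →L[ℝ] V} {x : M}
    (h : ∀ u, ContMDiffAt 𝓘(ℝ, E) 𝓘(ℝ, V) n (fun y ↦ f y u) x) :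
    ContMDiffAt 𝓘(ℝ, E) 𝓘(ℝ, F →L[ℝ] V) n f x := by
  let d := Module.finrank ℝ F
  have hd : d = Module.finrank ℝ (Fin d → ℝ) := (Module.finrank_fin_fun ℝ).symm
  let e₁ := ContinuousLinearEquiv.ofFinrankEq hd
  let e₂ := (e₁.arrowCongr (1 : V ≃L[ℝ] V)).trans (ContinuousLinearEquiv.piRing (Fin d))
  rw [← Function.id_comp f, ← e₂.symm_comp_self]
  refine e₂.symm.contDiff.contMDiff.contMDiffAt.comp x (contMDiffAt_pi_space.2 fun i ↦ ?_)
  exact h _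

variable [IsManifold 𝓘(ℝ, E) ∞ M]

omit [IsManifold 𝓘(ℝ, E) ∞ M] in
theorem isOpen_extChartAt_image {N : Set M} (hN : IsOpen N) {x₀ : M}
    (hsub : N ⊆ (chartAt E x₀).source) : IsOpen (extChartAt 𝓘(ℝ, E) x₀ '' N) := by
  simpa using (chartAt E x₀).isOpen_image_of_subset_source hN hsub

/-- A function with vanishing derivative near a point is constant near that point. -/
theorem eventually_eq_of_mvfderiv_eq_zero {N : Set M} (hN : IsOpen N) {f : M → V}
    (hf : ∀ x ∈ N, MDifferentiableAt 𝓘(ℝ, E) 𝓘(ℝ, V) f x)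
    (hf' : ∀ x ∈ N, mvfderiv 𝓘(ℝ, E) f x = 0) {x : M} (hx : x ∈ N) :
    ∀ᶠ y in 𝓝 x, f y = f x := by
  set φ := extChartAt 𝓘(ℝ, E) x with hφ
  have hW : IsOpen (φ '' (N ∩ (chartAt E x).source)) :=
    isOpen_extChartAt_image (hN.inter (chartAt E x).open_source) inter_subset_right
  have hxs : x ∈ N ∩ (chartAt E x).source := ⟨hx, mem_chart_source E x⟩
  obtain ⟨r, hr, hball⟩ := Metric.isOpen_iff.1 hW _ (mem_image_of_mem φ hxs)
  have hsymm : ∀ z ∈ Metric.ball (φ x) r, HasFDerivAt (f ∘ φ.symm) (0 : E →L[ℝ] V) z := by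
    intro z hz
    obtain ⟨y, hy, rfl⟩ := hball hz
    have hys : y ∈ φ.source := by rw [hφ, extChartAt_source]; exact hy.2
    have h1 : HasMFDerivAt 𝓘(ℝ, E) 𝓘(ℝ, V) f (φ.symm (φ y)) (0 : E →L[ℝ] V) := by
      rw [φ.left_inv hys]
      have h0 : (0 : E →L[ℝ] V) = mfderiv 𝓘(ℝ, E) 𝓘(ℝ, V) f y := (hf' y hy.1).symm
      have := (hf y hy.1).hasMFDerivAt
      rwa [← h0] at this
    have h2 : MDifferentiableAt 𝓘(ℝ, E) 𝓘(ℝ, E) φ.symm (φ y) :=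
      ((contMDiffOn_extChartAt_symm (n := ∞) x).contMDiffAt
        ((isOpen_extChartAt_target x).mem_nhds (φ.map_source hys))).mdifferentiableAt (by simp)
    have := (h1.comp _ h2.hasMFDerivAt).hasFDerivAt
    convert! this
  have hconst : ∀ z ∈ Metric.ball (φ x) r, (f ∘ φ.symm) z = (f ∘ φ.symm) (φ x) := by
    intro z hz
    exact Metric.isOpen_ball.is_const_of_fderiv_eq_zero (convex_ball _ r).isPreconnected
      (fun w hw ↦ (hsymm w hw).differentiableAt.differentiableWithinAt)
      (fun w hw ↦ (hsymm w hw).fderiv) hz (Metric.mem_ball_self hr)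
  have hnear : ∀ᶠ y in 𝓝 x, φ y ∈ Metric.ball (φ x) r :=
    (continuousAt_extChartAt (I := 𝓘(ℝ, E)) x).eventually (Metric.ball_mem_nhds _ hr)
  filter_upwards [hnear, extChartAt_source_mem_nhds (I := 𝓘(ℝ, E)) x] with y hy hys
  have := hconst _ hy
  simpa [φ.left_inv hys, φ.left_inv (mem_extChartAt_source (I := 𝓘(ℝ, E)) x)] using this

/-- The one-form `θ` is smooth at `x`. -/
def SmoothFormAt (θ : Π x : M, TangentSpace 𝓘(ℝ, E) x →L[ℝ] V) (x : M) : Prop :=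
  ∀ v : TangentSpace 𝓘(ℝ, E) x, ContMDiffAt 𝓘(ℝ, E).tangent 𝓘(ℝ, V) ∞
    (fun p : TangentBundle 𝓘(ℝ, E) M ↦ θ p.proj p.snd) ⟨x, v⟩

variable {θ : Π x : M, TangentSpace 𝓘(ℝ, E) x →L[ℝ] V} {x : M}
  {Y : Π x : M, TangentSpace 𝓘(ℝ, E) x}

theorem SmoothFormAt.contMDiffAt_pairing (hθ : SmoothFormAt θ x)
    (hY : ContMDiffAt 𝓘(ℝ, E) 𝓘(ℝ, E).tangent ∞
      (fun x ↦ (⟨x, Y x⟩ : TangentBundle 𝓘(ℝ, E) M)) x) :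
    ContMDiffAt 𝓘(ℝ, E) 𝓘(ℝ, V) ∞ (pairing θ Y) x :=
  (hθ (Y x)).comp x hY

theorem SmoothFormAt.mdifferentiableAt_pairing (hθ : SmoothFormAt θ x)
    (hY : MDifferentiableAt 𝓘(ℝ, E) 𝓘(ℝ, E).tangent
      (fun x ↦ (⟨x, Y x⟩ : TangentBundle 𝓘(ℝ, E) M)) x) :
    MDifferentiableAt 𝓘(ℝ, E) 𝓘(ℝ, V) (pairing θ Y) x :=
  ((hθ (Y x)).mdifferentiableAt (by simp)).comp x hY

/-- The vector fields dual to a smooth coframe are smooth. -/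
theorem SmoothFormAt.contMDiffAt_symm [FiniteDimensional ℝ E]
    {a : Π x : M, TangentSpace 𝓘(ℝ, E) x ≃L[ℝ] E} {x₀ : M}
    (ha : SmoothFormAt (fun x ↦ (a x : TangentSpace 𝓘(ℝ, E) x →L[ℝ] E)) x₀) (u : E) :
    ContMDiffAt 𝓘(ℝ, E) 𝓘(ℝ, E).tangent ∞
      (fun x ↦ (⟨x, (a x).symm u⟩ : TangentBundle 𝓘(ℝ, E) M)) x₀ := by
  let e := trivializationAt E (TangentSpace 𝓘(ℝ, E) : M → Type _) x₀
  have hx₀ : x₀ ∈ e.baseSet := FiberBundle.mem_baseSet_trivializationAt' x₀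
  have hsec : ∀ w : E, ContMDiffAt 𝓘(ℝ, E) 𝓘(ℝ, E).tangent ∞
      (fun x ↦ (⟨x, e.symmL ℝ x w⟩ : TangentBundle 𝓘(ℝ, E) M)) x₀ := by
    intro w
    refine (e.contMDiffAt_section_iff (IB := 𝓘(ℝ, E)) (s := fun x ↦ e.symmL ℝ x w) hx₀).2 ?_
    refine (contMDiffAt_const (c := w)).congr_of_eventuallyEq ?_
    filter_upwards [e.open_baseSet.mem_nhds hx₀] with y hy
    simp only [e.symmL_apply hy, e.apply_mk_symm hy]
  -- `T` is the coframe in a trivialization. The dual field of `u` has components `T⁻¹ u` there, and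
  -- operator inversion is smooth at invertible operators.
  let T : M → E →L[ℝ] E := fun x ↦ (a x : TangentSpace 𝓘(ℝ, E) x →L[ℝ] E).comp (e.symmL ℝ x)
  have hT : ContMDiffAt 𝓘(ℝ, E) 𝓘(ℝ, E →L[ℝ] E) ∞ T x₀ :=
    contMDiffAt_clm_of_apply fun w ↦ ha.contMDiffAt_pairing (hsec w)
  have hTe : ∀ y (hy : y ∈ e.baseSet), T y =
      (((e.continuousLinearEquivAt ℝ y hy).symm.trans (a y) : E ≃L[ℝ] E) : E →L[ℝ] E) := by
    intro y hy
    rw [← ContinuousLinearEquiv.comp_coe, e.symm_continuousLinearEquivAt_eq' hy]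
  have hinv : ContMDiffAt 𝓘(ℝ, E) 𝓘(ℝ, E →L[ℝ] E) ∞ (fun x ↦ (T x).inverse) x₀ := by
    have h1 : ContDiffAt ℝ ∞ ContinuousLinearMap.inverse (T x₀) := by
      rw [hTe x₀ hx₀]
      exact contDiffAt_map_inverse _
    exact h1.contMDiffAt.comp x₀ hT
  refine (e.contMDiffAt_section_iff (IB := 𝓘(ℝ, E)) (s := fun x ↦ (a x).symm u) hx₀).2 ?_
  refine (hinv.clm_apply (contMDiffAt_const (c := u))).congr_of_eventuallyEq ?_
  filter_upwards [e.open_baseSet.mem_nhds hx₀] with y hy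
  rw [hTe y hy, ContinuousLinearMap.inverse_equiv]
  rfl

end ManifoldCalculus

/-! ### Commuting coordinate frames extended to global fields. -/

section CoordinateFields

open Set Filter Topology VectorField

variable {E : Type*} [NormedAddCommGroup E] [NormedSpace ℝ E]
  {M : Type*} [TopologicalSpace M] [ChartedSpace E M]

/-- The differential of the chart at `x₀`, as an `E`-valued one-form. -/
noncomputable def chartForm (x₀ x : M) : TangentSpace 𝓘(ℝ, E) x →L[ℝ] E :=
  mfderiv 𝓘(ℝ, E) 𝓘(ℝ, E) (extChartAt 𝓘(ℝ, E) x₀) x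

variable [IsManifold 𝓘(ℝ, E) ∞ M]

theorem isInvertible_chartForm {x₀ x : M} (hx : x ∈ (chartAt E x₀).source) :
    (chartForm x₀ x : TangentSpace 𝓘(ℝ, E) x →L[ℝ] E).IsInvertible :=
  isInvertible_mfderiv_extChartAt (by rwa [extChartAt_source])

/-- Over the chart domain, the differential of the chart is the fibre component of the tangent
bundle trivialization at `x₀`. -/
theorem smoothFormAt_chartForm {x₀ x : M} (hx : x ∈ (chartAt E x₀).source) :
    SmoothFormAt (chartForm (E := E) x₀) x := by
  intro v
  let e := trivializationAt E (TangentSpace 𝓘(ℝ, E) : M → Type _) x₀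
  have hx' : (⟨x, v⟩ : TangentBundle 𝓘(ℝ, E) M) ∈ e.source := by
    rw [e.mem_source]; exact hx
  have h1 := (e.contMDiffOn (IB := 𝓘(ℝ, E)) (n := ∞)).contMDiffAt (e.open_source.mem_nhds hx')
  have h2 := contMDiffAt_snd.comp _ h1
  refine h2.congr_of_eventuallyEq ?_
  filter_upwards [e.open_source.mem_nhds hx'] with p hp
  have hp' : p.proj ∈ (chartAt E x₀).source := by rw [e.mem_source] at hp; exact hp
  rw [chartForm, ← TangentBundle.continuousLinearMapAt_trivializationAt hp',
    Bundle.Trivialization.continuousLinearMapAt_apply,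
    Bundle.Trivialization.coe_linearMapAt_of_mem _ hp']
  rfl

/-- The constant vector field on a vector space. -/
def constField (u : E) (x : E) : TangentSpace 𝓘(ℝ, E) x := u

theorem contMDiffAt_constField (u z : E) : ContMDiffAt 𝓘(ℝ, E) 𝓘(ℝ, E).tangent ∞
    (fun y : E ↦ (⟨y, constField u y⟩ : TangentBundle 𝓘(ℝ, E) E)) z :=
  contMDiffAt_vectorSpace_iff_contDiffAt.2 contDiffAt_const

theorem mlieBracket_constField (u v z : E) :
    mlieBracket 𝓘(ℝ, E) (constField u) (constField v) z = 0 := by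
  rw [← mlieBracketWithin_univ, mlieBracketWithin_eq_lieBracketWithin]
  have h : ∀ w : E, fderivWithin ℝ (constField w : E → E) univ z = 0 := fun w ↦
    fderivWithin_const_apply w
  simp only [lieBracketWithin]
  erw [h u, h v]
  exact sub_self (0 : E)

variable [FiniteDimensional ℝ E] [T2Space M]

/-- Near every point, the coordinate vector fields extend to global smooth vector fields. -/
theorem exists_coordinateFields (x₀ : M) :
    ∃ (N : Set M) (B : Π x : M, E →L[ℝ] TangentSpace 𝓘(ℝ, E) x), IsOpen N ∧ x₀ ∈ N ∧
      N ⊆ (chartAt E x₀).source ∧ (∀ u, IsSmoothField fun x ↦ B x u) ∧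
      (∀ x ∈ N, ∀ u, chartForm x₀ x (B x u) = u) ∧
      (∀ x ∈ N, ∀ v, B x (chartForm x₀ x v) = v) ∧
      ∀ x ∈ N, ∀ u v, mlieBracket 𝓘(ℝ, E) (fun x ↦ B x u) (fun x ↦ B x v) x = 0 := by
  -- `IsFlat` tests global smooth fields only, so the coordinate fields are cut off by a bump
  -- function equal to `1` on `N`.
  let b : SmoothBumpFunction 𝓘(ℝ, E) x₀ := Classical.arbitrary _
  have hb1 : ∀ᶠ x in 𝓝 x₀, b x = 1 := b.eventuallyEq_one
  obtain ⟨N₁, hN₁, hN₁o, hxN₁⟩ := eventually_nhds_iff.1 hb1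
  set N := N₁ ∩ (chartAt E x₀).source with hN
  have hNo : IsOpen N := hN₁o.inter (chartAt E x₀).open_source
  have hpull : ∀ (u : E) x, x ∈ (chartAt E x₀).source → ContMDiffAt 𝓘(ℝ, E) 𝓘(ℝ, E).tangent ∞
      (fun x ↦ (⟨x, mpullback 𝓘(ℝ, E) 𝓘(ℝ, E) (extChartAt 𝓘(ℝ, E) x₀) (constField u) x⟩ :
        TangentBundle 𝓘(ℝ, E) M)) x := by
    intro u x hx
    have hinv : (mfderiv 𝓘(ℝ, E) 𝓘(ℝ, E) (extChartAt 𝓘(ℝ, E) x₀) x).IsInvertible :=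
      isInvertible_mfderiv_extChartAt (by rwa [extChartAt_source])
    exact ContMDiffAt.mpullback_vectorField_preimage (n := ∞) (contMDiffAt_constField u _)
      (contMDiffAt_extChartAt' hx) hinv (by simp)
  have hBeq : ∀ u : E, ∀ x ∈ N, b x • (chartForm x₀ x).inverse u =
      mpullback 𝓘(ℝ, E) 𝓘(ℝ, E) (extChartAt 𝓘(ℝ, E) x₀) (constField u) x := by
    intro u x hx
    rw [hN₁ x hx.1, one_smul]
    rfl
  refine ⟨N, fun x ↦ b x • (chartForm x₀ x).inverse, hNo, ⟨hxN₁, mem_chart_source E x₀⟩,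
    inter_subset_right, fun u ↦ ?_, fun x hx u ↦ ?_, fun x hx v ↦ ?_, fun x hx u v ↦ ?_⟩
  · exact ContMDiffOn.smul_section_of_tsupport (V := fun x : M ↦ TangentSpace 𝓘(ℝ, E) x)
      (s := fun x ↦ (chartForm x₀ x).inverse u) b.contMDiff.contMDiffOn
      (chartAt E x₀).open_source b.tsupport_subset_chartAt_source
      fun x hx ↦ (hpull u x hx).contMDiffWithinAt
  · simp only [hN₁ x hx.1, one_smul]
    exact (isInvertible_chartForm hx.2).self_apply_inverse u
  · simp only [hN₁ x hx.1, one_smul]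
    exact (isInvertible_chartForm hx.2).inverse_apply_self v
  -- Near points of `N` the fields are pullbacks of constant fields, and pullback commutes with the
  -- bracket.
  · have hev : ∀ u : E, (fun x ↦ (b x • (chartForm x₀ x).inverse) u) =ᶠ[𝓝 x]
        mpullback 𝓘(ℝ, E) 𝓘(ℝ, E) (extChartAt 𝓘(ℝ, E) x₀) (constField u) := fun u ↦ by
      filter_upwards [hNo.mem_nhds hx] with y hy using hBeq u y hy
    rw [(hev u).mlieBracket_vectorField_eq (hev v)]
    have : IsManifold 𝓘(ℝ, E) (minSmoothness ℝ 2) M := by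
      rw [minSmoothness_of_isRCLikeNormedField]; infer_instance
    have hc := fun u z : E ↦ (contMDiffAt_constField u z).mdifferentiableAt (by simp)
    rw [← mpullback_mlieBracket (n := ∞) (hc u _) (hc v _) (contMDiffAt_extChartAt' hx.2)
      (by
      rw [minSmoothness_of_isRCLikeNormedField]; exact ENat.LEInfty.out)]
    rw [mpullback_apply, mlieBracket_constField, map_zero]

end CoordinateFields

/-! ### Parallel one-forms and tensoriality. -/

section CovariantDerivatives

open Set Filter Topology VectorField

variable {E : Type*} [NormedAddCommGroup E] [NormedSpace ℝ E]
  {M : Type*} [TopologicalSpace M] [ChartedSpace E M] [IsManifold 𝓘(ℝ, E) ∞ M]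
  {V : Type*} [NormedAddCommGroup V] [NormedSpace ℝ V]
  (D : CovariantDerivative 𝓘(ℝ, E) E (TangentSpace 𝓘(ℝ, E) : M → Type _))

theorem IsSmoothField.contMDiffAt {X : Π x : M, TangentSpace 𝓘(ℝ, E) x} (hX : IsSmoothField X)
    (x : M) : ContMDiffAt 𝓘(ℝ, E) 𝓘(ℝ, E).tangent ∞
      (fun x ↦ (⟨x, X x⟩ : TangentBundle 𝓘(ℝ, E) M)) x :=
  ContMDiff.contMDiffAt hX

theorem IsSmoothField.mdifferentiableAt {X : Π x : M, TangentSpace 𝓘(ℝ, E) x}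
    (hX : IsSmoothField X) (x : M) : MDifferentiableAt 𝓘(ℝ, E) 𝓘(ℝ, E).tangent
      (fun x ↦ (⟨x, X x⟩ : TangentBundle 𝓘(ℝ, E) M)) x :=
  (hX.contMDiffAt x).mdifferentiableAt (by simp)

theorem IsSmoothField.nabla {X Y : Π x : M, TangentSpace 𝓘(ℝ, E) x}
    [hD : CovariantDerivative.ContMDiffCovariantDerivative D ∞]
    (hX : IsSmoothField X) (hY : IsSmoothField Y) : IsSmoothField (nabla D X Y) := by
  have hY' : ContMDiffOn 𝓘(ℝ, E) 𝓘(ℝ, E).tangent (∞ + 1)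
      (fun x ↦ (⟨x, Y x⟩ : TangentBundle 𝓘(ℝ, E) M)) univ := by
    simpa using! ContMDiff.contMDiffOn (s := univ) hY
  have h := hD.contMDiff.contMDiff hY'
  exact ContMDiff.clm_bundle_apply (contMDiffOn_univ.1 h) hX

/-- The failure of a one-form to be parallel is tensorial. -/
theorem SmoothFormAt.tensorialAt {θ : Π x : M, TangentSpace 𝓘(ℝ, E) x →L[ℝ] V} {x : M}
    (hθ : SmoothFormAt θ x) (v : TangentSpace 𝓘(ℝ, E) x) :
    TensorialAt 𝓘(ℝ, E) E (fun Y : Π x : M, TangentSpace 𝓘(ℝ, E) x ↦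
      θ x (D Y x v) - mvfderiv 𝓘(ℝ, E) (pairing θ Y) x v) x where
  smul {f Y} hf hY := by
    have h1 : pairing θ (f • Y) = f • pairing θ Y := by
      ext y; simp [pairing]
    rw [h1, mvfderiv_smul hf (hθ.mdifferentiableAt_pairing hY),
      D.isCovariantDerivativeOnUniv.leibniz hY hf]
    simp [pairing, smul_sub]
  add {Y Y'} hY hY' := by
    have h1 : pairing θ (Y + Y') = pairing θ Y + pairing θ Y' := by
      ext y; simp [pairing]
    rw [h1, mvfderiv_add (hθ.mdifferentiableAt_pairing hY) (hθ.mdifferentiableAt_pairing hY'),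
      D.isCovariantDerivativeOnUniv.add hY hY']
    simp
    abel

/-- Tensoriality lets parallelism be checked on one convenient field with the prescribed value at
`x`. -/
theorem SmoothFormAt.apply_covariantDerivative_sub [FiniteDimensional ℝ E]
    {θ : Π x : M, TangentSpace 𝓘(ℝ, E) x →L[ℝ] V} {x : M}
    (hθ : SmoothFormAt θ x) {Y Y' : Π x : M, TangentSpace 𝓘(ℝ, E) x}
    (hY : MDifferentiableAt 𝓘(ℝ, E) 𝓘(ℝ, E).tangent
      (fun x ↦ (⟨x, Y x⟩ : TangentBundle 𝓘(ℝ, E) M)) x)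
    (hY' : MDifferentiableAt 𝓘(ℝ, E) 𝓘(ℝ, E).tangent
      (fun x ↦ (⟨x, Y' x⟩ : TangentBundle 𝓘(ℝ, E) M)) x) (h : Y x = Y' x)
    (v : TangentSpace 𝓘(ℝ, E) x) :
    θ x (D Y x v) - mvfderiv 𝓘(ℝ, E) (pairing θ Y) x v =
      θ x (D Y' x v) - mvfderiv 𝓘(ℝ, E) (pairing θ Y') x v :=
  have : ContMDiffVectorBundle 1 E (TangentSpace 𝓘(ℝ, E) : M → Type _) 𝓘(ℝ, E) :=
    ContMDiffVectorBundle.of_le (n := ∞) (by simp)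
  (hθ.tensorialAt D v).pointwise hY hY' h

/-- The one-form `θ` is parallel at `x`, tested on fields differentiable at `x`. -/
def IsParallelAt (θ : Π x : M, TangentSpace 𝓘(ℝ, E) x →L[ℝ] V) (x : M) : Prop :=
  ∀ Y : Π x : M, TangentSpace 𝓘(ℝ, E) x, MDifferentiableAt 𝓘(ℝ, E) 𝓘(ℝ, E).tangent
      (fun x ↦ (⟨x, Y x⟩ : TangentBundle 𝓘(ℝ, E) M)) x →
    ∀ v, mvfderiv 𝓘(ℝ, E) (pairing θ Y) x v = θ x (D Y x v)

end CovariantDerivatives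

/-! ### Regularity of transport and the connection form. -/

section LocalParallelCoframe

open Set Filter Topology VectorField

variable {E : Type*} [NormedAddCommGroup E] [NormedSpace ℝ E]

/-- Solutions of `dα = α Γ` are smooth. -/
theorem contDiffOn_of_hasFDerivAt_mul {A : Type*} [NormedRing A] [NormedAlgebra ℝ A]
    {Γ : E → E →L[ℝ] A} {α : E → A} {s : Set E} (hs : IsOpen s) (hΓ : ContDiffOn ℝ ∞ Γ s)
    (h : ∀ y ∈ s, HasFDerivAt α ((ContinuousLinearMap.mul ℝ A (α y)).comp (Γ y)) y) :
    ContDiffOn ℝ ∞ α s := by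
  refine contDiffOn_infty.2 fun n ↦ ?_
  induction n with
  | zero =>
    exact contDiffOn_zero.2 fun y hy ↦ (h y hy).continuousAt.continuousWithinAt
  | succ n ih =>
    push_cast
    refine (contDiffOn_succ_iff_fderiv_of_isOpen hs).2
      ⟨fun y hy ↦ (h y hy).differentiableAt.differentiableWithinAt, by simp, ?_⟩
    -- Bootstrap: if `α` is `C^n`, then so is its derivative `α Γ`.
    have h1 : ContDiffOn ℝ n (fun y ↦ (ContinuousLinearMap.mul ℝ A (α y)).comp (Γ y)) s :=
      ((ContinuousLinearMap.mul ℝ A).contDiff.comp_contDiffOn ih).clm_comp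
        (contDiffOn_infty.1 hΓ n)
    exact h1.congr fun y hy ↦ (h y hy).fderiv

variable {M : Type*} [TopologicalSpace M] [ChartedSpace E M] [IsManifold 𝓘(ℝ, E) ∞ M]
  {V : Type*} [NormedAddCommGroup V] [NormedSpace ℝ V]
  (D : CovariantDerivative 𝓘(ℝ, E) E (TangentSpace 𝓘(ℝ, E) : M → Type _))

omit [IsManifold 𝓘(ℝ, E) ∞ M] in
theorem mvfderiv_congr {f g : M → V} {x : M} (h : f =ᶠ[𝓝 x] g) :
    mvfderiv 𝓘(ℝ, E) f x = mvfderiv 𝓘(ℝ, E) g x := by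
  have h1 := h.mfderiv_eq (I := 𝓘(ℝ, E)) (I' := 𝓘(ℝ, V))
  ext v
  exact congrArg (fun T : E →L[ℝ] V ↦ T v) h1

theorem mvfderiv_comp_extChartAt {f : E → V} {x₀ x : M} (hx : x ∈ (chartAt E x₀).source)
    (hf : DifferentiableAt ℝ f (extChartAt 𝓘(ℝ, E) x₀ x)) (v : TangentSpace 𝓘(ℝ, E) x) :
    mvfderiv 𝓘(ℝ, E) (fun y ↦ f (extChartAt 𝓘(ℝ, E) x₀ y)) x v =
      fderiv ℝ f (extChartAt 𝓘(ℝ, E) x₀ x) (chartForm x₀ x v) := by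
  have h1 := hf.hasFDerivAt.hasMFDerivAt
  have h2 : HasMFDerivAt 𝓘(ℝ, E) 𝓘(ℝ, E) (extChartAt 𝓘(ℝ, E) x₀) x (chartForm x₀ x) :=
    ((contMDiffAt_extChartAt' (n := ∞) hx).mdifferentiableAt (by simp)).hasMFDerivAt
  have h3 := (h1.comp x h2).mfderiv
  exact congrArg (fun T : E →L[ℝ] V ↦ T v) h3

variable [FiniteDimensional ℝ E] {B : Π x : M, E →L[ℝ] TangentSpace 𝓘(ℝ, E) x}

/-- The connection form of `D` with respect to a frame `B` and a coframe `c`. -/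
noncomputable def christoffelForm (c : Π x : M, TangentSpace 𝓘(ℝ, E) x →L[ℝ] E)
    (hB : ∀ u, IsSmoothField fun x ↦ B x u) (x : M) : E →L[ℝ] E →L[ℝ] E :=
  (LinearMap.toContinuousLinearMap
    { toFun := fun w : E ↦ (c x).comp ((D (fun y ↦ B y w) x).comp (B x))
      map_add' := fun w w' ↦ by
        have h : (fun y ↦ B y (w + w')) = (fun y ↦ B y w) + fun y ↦ B y w' := by
          ext y; exact map_add _ _ _
        rw [h, D.isCovariantDerivativeOnUniv.add ((hB w).mdifferentiableAt x)
          ((hB w').mdifferentiableAt x)]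
        ext u; simp
      map_smul' := fun r w ↦ by
        have h : (fun y ↦ B y (r • w)) = r • (fun y ↦ B y w) := by
          ext y; exact map_smul _ _ _
        rw [h, D.isCovariantDerivativeOnUniv.smul_const r ((hB w).mdifferentiableAt x)]
        ext u; simp } : E →L[ℝ] E →L[ℝ] E).flip

theorem christoffelForm_apply (c : Π x : M, TangentSpace 𝓘(ℝ, E) x →L[ℝ] E)
    (hB : ∀ u, IsSmoothField fun x ↦ B x u) (x : M) (u w : E) :
    christoffelForm D c hB x u w = c x (D (fun y ↦ B y w) x (B x u)) := rfl

theorem contMDiffAt_christoffelForm [CovariantDerivative.ContMDiffCovariantDerivative D ∞]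
    {c : Π x : M, TangentSpace 𝓘(ℝ, E) x →L[ℝ] E}
    (hB : ∀ u, IsSmoothField fun x ↦ B x u) {x : M} (hc : SmoothFormAt c x) :
    ContMDiffAt 𝓘(ℝ, E) 𝓘(ℝ, E →L[ℝ] E →L[ℝ] E) ∞ (christoffelForm D c hB) x :=
  contMDiffAt_clm_of_apply fun u ↦ contMDiffAt_clm_of_apply fun w ↦
    hc.contMDiffAt_pairing (((hB u).nabla D (hB w)).contMDiffAt x)

end LocalParallelCoframe

/-! ### Local parallel coframes of a flat connection. -/

section LocalParallelCoframe

open Set Filter Topology VectorField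

variable {E : Type*} [NormedAddCommGroup E] [NormedSpace ℝ E]
  {M : Type*} [TopologicalSpace M] [ChartedSpace E M] [IsManifold 𝓘(ℝ, E) ∞ M]
  (D : CovariantDerivative 𝓘(ℝ, E) E (TangentSpace 𝓘(ℝ, E) : M → Type _))
  [FiniteDimensional ℝ E] {B : Π x : M, E →L[ℝ] TangentSpace 𝓘(ℝ, E) x}
  {c : Π x : M, TangentSpace 𝓘(ℝ, E) x →L[ℝ] E} {N : Set M}

/-- `Y` is compared with the frame field of constant coefficients `c x (Y x)`, whose pairing with
`c` has zero derivative. -/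
theorem coframe_covariantDerivative (hB : ∀ u, IsSmoothField fun x ↦ B x u) (hN : IsOpen N)
    (hcB : ∀ x ∈ N, ∀ u, c x (B x u) = u) (hBc : ∀ x ∈ N, ∀ v, B x (c x v) = v)
    {x : M} (hx : x ∈ N) (hc : SmoothFormAt c x) {Y : Π x : M, TangentSpace 𝓘(ℝ, E) x}
    (hY : MDifferentiableAt 𝓘(ℝ, E) 𝓘(ℝ, E).tangent
      (fun x ↦ (⟨x, Y x⟩ : TangentBundle 𝓘(ℝ, E) M)) x) (u : E) :
    c x (D Y x (B x u)) =
      mvfderiv 𝓘(ℝ, E) (pairing c Y) x (B x u) + christoffelForm D c hB x u (c x (Y x)) := by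
  have h := hc.apply_covariantDerivative_sub D hY ((hB (c x (Y x))).mdifferentiableAt x)
    (hBc x hx _).symm (B x u)
  have h0 : mvfderiv 𝓘(ℝ, E) (pairing c fun y ↦ B y (c x (Y x))) x = 0 := by
    rw [mvfderiv_congr (g := fun _ ↦ c x (Y x)), mvfderiv_const]
    filter_upwards [hN.mem_nhds hx] with y hy using hcB y hy _
  rw [h0, zero_apply, sub_zero, ← christoffelForm_apply D c hB] at h
  rw [← h]
  abel

/-- The frame fields commute at `x`, so the curvature loses its bracket term there; the two others
are expanded by `coframe_covariantDerivative`. -/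
theorem IsFlat.christoffelForm_eq [CovariantDerivative.ContMDiffCovariantDerivative D ∞]
    (hD : IsFlat D) (hB : ∀ u, IsSmoothField fun x ↦ B x u) (hN : IsOpen N)
    (hcB : ∀ x ∈ N, ∀ u, c x (B x u) = u) (hBc : ∀ x ∈ N, ∀ v, B x (c x v) = v)
    {x : M} (hx : x ∈ N) (hc : SmoothFormAt c x)
    (hbr : ∀ u v, mlieBracket 𝓘(ℝ, E) (fun x ↦ B x u) (fun x ↦ B x v) x = 0) (u v w : E) :
    mvfderiv 𝓘(ℝ, E) (fun y ↦ christoffelForm D c hB y v w) x (B x u) +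
        christoffelForm D c hB x u (christoffelForm D c hB x v w) =
      mvfderiv 𝓘(ℝ, E) (fun y ↦ christoffelForm D c hB y u w) x (B x v) +
        christoffelForm D c hB x v (christoffelForm D c hB x u w) := by
  have h := hD _ _ _ (hB u) (hB v) (hB w) x
  have h1 : ∀ u v : E, c x (nabla D (fun x ↦ B x u)
      (nabla D (fun x ↦ B x v) (fun x ↦ B x w)) x) =
      mvfderiv 𝓘(ℝ, E) (fun y ↦ christoffelForm D c hB y v w) x (B x u) +
        christoffelForm D c hB x u (christoffelForm D c hB x v w) := fun u v ↦
    coframe_covariantDerivative D hB hN hcB hBc hx hc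
      (((hB v).nabla D (hB w)).mdifferentiableAt x) u
  rw [← h1, ← h1]
  have h2 : nabla D (mlieBracket 𝓘(ℝ, E) (fun x ↦ B x u) fun x ↦ B x v) (fun x ↦ B x w) x = 0 := by
    rw [nabla, hbr, map_zero]
  rw [h2, sub_zero, sub_eq_zero] at h
  rw [h]

/-- A flat connection admits a parallel coframe near every point. -/
theorem IsFlat.exists_local_parallel_coframe [T2Space M]
    [CovariantDerivative.ContMDiffCovariantDerivative D ∞] (hD : IsFlat D) (x₀ : M) :
    ∃ N : Set M, IsOpen N ∧ x₀ ∈ N ∧ ∃ a : Π x : M, TangentSpace 𝓘(ℝ, E) x ≃L[ℝ] E,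
      ∀ x ∈ N, SmoothFormAt (fun x ↦ (a x : TangentSpace 𝓘(ℝ, E) x →L[ℝ] E)) x ∧
        IsParallelAt D (fun x ↦ (a x : TangentSpace 𝓘(ℝ, E) x →L[ℝ] E)) x := by
  obtain ⟨N, B, hN, hx₀, hNs, hB, hcB, hBc, hbr⟩ := exists_coordinateFields (E := E) x₀
  set φ := extChartAt 𝓘(ℝ, E) x₀ with hφ
  have hφs : ∀ x ∈ N, φ.symm (φ x) = x := fun x hx ↦
    φ.left_inv (by rw [hφ, extChartAt_source]; exact hNs hx)
  set c := chartForm (E := E) x₀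
  have hc : ∀ x ∈ N, SmoothFormAt c x := fun x hx ↦ smoothFormAt_chartForm (hNs hx)
  let Γ : E → E →L[ℝ] E →L[ℝ] E := fun y ↦ christoffelForm D c hB (φ.symm y)
  set U : Set E := φ '' N
  have hU : IsOpen U := isOpen_extChartAt_image hN hNs
  have hΓ : ContDiffOn ℝ ∞ Γ U := by
    rintro _ ⟨x, hx, rfl⟩
    have h1 : ContMDiffAt 𝓘(ℝ, E) 𝓘(ℝ, E →L[ℝ] E →L[ℝ] E) ∞ (christoffelForm D c hB)
        (φ.symm (φ x)) := by
      rw [hφs x hx]; exact contMDiffAt_christoffelForm D hB (hc x hx)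
    have h2 : ContMDiffAt 𝓘(ℝ, E) 𝓘(ℝ, E) ∞ φ.symm (φ x) :=
      (contMDiffOn_extChartAt_symm x₀).contMDiffAt ((isOpen_extChartAt_target x₀).mem_nhds
        (φ.map_source (by rw [hφ, extChartAt_source]; exact hNs hx)))
    exact (h1.comp _ h2).contDiffAt.contDiffWithinAt
  have hΓd : ∀ x ∈ N, ∀ u v w : E, fderiv ℝ Γ (φ x) u v w =
      mvfderiv 𝓘(ℝ, E) (fun y ↦ christoffelForm D c hB y v w) x (B x u) := by
    intro x hx u v w
    have h1 : HasFDerivAt Γ (fderiv ℝ Γ (φ x)) (φ x) :=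
      ((hΓ.contDiffAt (hU.mem_nhds (mem_image_of_mem φ hx))).differentiableAt
        (by simp)).hasFDerivAt
    have h2 := (h1.clm_apply (hasFDerivAt_const v (φ x))).clm_apply (hasFDerivAt_const w (φ x))
    rw [mvfderiv_congr (g := fun y ↦ Γ (φ y) v w),
      mvfderiv_comp_extChartAt (f := fun y ↦ Γ y v w) (hNs hx) h2.differentiableAt, h2.fderiv]
    · have h3 : chartForm x₀ x (B x u) = u := hcB x hx u
      simp [h3]
    · filter_upwards [hN.mem_nhds hx] with y hy
      simp only [Γ, hφs y hy]
  have hflat : ∀ y ∈ U, ∀ u v : E,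
      fderiv ℝ Γ y u v + Γ y u * Γ y v = fderiv ℝ Γ y v u + Γ y v * Γ y u := by
    rintro _ ⟨x, hx, rfl⟩ u v
    ext w
    have := hD.christoffelForm_eq D hB hN hcB hBc hx (hc x hx) (hbr x hx) u v w
    rw [← hΓd x hx, ← hΓd x hx] at this
    simpa [Γ, hφs x hx] using this
  -- The norm of the identity is only bounded by `1`, since it is `0` when `E` is trivial.
  obtain ⟨r, hr, hrU, α, hα₀, hα⟩ := exists_transport_of_flat
    (A := E →L[ℝ] E) ContinuousLinearMap.norm_id_le hU (mem_image_of_mem φ hx₀)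
    (hΓ.of_le (by simp)) hflat
  have hαs : ContDiffOn ℝ ∞ α (Metric.ball (φ x₀) r) :=
    contDiffOn_of_hasFDerivAt_mul Metric.isOpen_ball (hΓ.mono hrU) hα
  -- `α` is the identity at the centre and invertibility is an open condition.
  have hinv : ∀ᶠ x in 𝓝 x₀, φ x ∈ Metric.ball (φ x₀) r ∧ (α (φ x)).IsInvertible := by
    have h1 : ContinuousAt φ x₀ := continuousAt_extChartAt x₀
    have h2 : ContinuousAt α (φ x₀) := (hα _ (Metric.mem_ball_self hr)).continuousAt
    refine (h1.eventually (Metric.ball_mem_nhds _ hr)).and ((h2.comp h1).eventually ?_)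
    have h3 := ContinuousLinearEquiv.nhds (ContinuousLinearEquiv.refl ℝ E)
    filter_upwards [show _ ∈ 𝓝 (α (φ x₀)) by rw [hα₀]; exact h3] with T hT
    obtain ⟨e, he⟩ := hT
    exact ⟨e, he⟩
  obtain ⟨N₁, hN₁, hN₁o, hxN₁⟩ := eventually_nhds_iff.1 hinv
  have hcomp : ∀ x ∈ N ∩ N₁, ((α (φ x)).comp (c x)).IsInvertible := fun x hx ↦
    (hN₁ x hx.2).2.comp (isInvertible_chartForm (hNs hx.1))
  classical
  let a : Π x : M, TangentSpace 𝓘(ℝ, E) x ≃L[ℝ] E := fun x ↦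
    if hx : x ∈ N ∩ N₁ then (hcomp x hx).choose else ContinuousLinearEquiv.refl ℝ E
  have ha : ∀ x ∈ N ∩ N₁, (a x : TangentSpace 𝓘(ℝ, E) x →L[ℝ] E) = (α (φ x)).comp (c x) := by
    intro x hx
    have h : a x = (hcomp x hx).choose := dif_pos hx
    rw [h]
    exact (hcomp x hx).choose_spec
  refine ⟨N ∩ N₁, hN.inter hN₁o, ⟨hx₀, hxN₁⟩, a, fun x hx ↦ ?_⟩
  have hsm : SmoothFormAt (fun x ↦ (a x : TangentSpace 𝓘(ℝ, E) x →L[ℝ] E)) x := by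
    intro v
    have h1 : ContMDiffAt 𝓘(ℝ, E).tangent 𝓘(ℝ, E) ∞
        (fun p : TangentBundle 𝓘(ℝ, E) M ↦ p.proj) ⟨x, v⟩ :=
      (Bundle.contMDiff_proj (TangentSpace 𝓘(ℝ, E) : M → Type _)).contMDiffAt
    have h2 : ContMDiffAt 𝓘(ℝ, E) 𝓘(ℝ, E →L[ℝ] E) ∞ (fun y ↦ α (φ y)) x :=
      (hαs.contDiffAt (Metric.isOpen_ball.mem_nhds (hN₁ x hx.2).1)).contMDiffAt.comp x
        (contMDiffAt_extChartAt' (hNs hx.1))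
    refine ((h2.comp (⟨x, v⟩ : TangentBundle 𝓘(ℝ, E) M) h1).clm_apply
      (hc x hx.1 v)).congr_of_eventuallyEq ?_
    filter_upwards [h1.continuousAt.preimage_mem_nhds ((hN.inter hN₁o).mem_nhds hx)] with p hp
    simp only [ha p.proj hp]
    rfl
  refine ⟨hsm, fun Y hY v ↦ ?_⟩
  have h := hsm.apply_covariantDerivative_sub D hY ((hB (c x (Y x))).mdifferentiableAt x)
    (hBc x hx.1 _).symm v
  set w := c x (Y x)
  have hαx := hα _ (hN₁ x hx.2).1
  -- On the frame field `B w` the pairing is `α w` in coordinates, so the transport equation `dα = α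
  -- Γ` is parallelism; tensoriality covers every `Y`.
  have hd : mvfderiv 𝓘(ℝ, E) (pairing (fun x ↦ (a x : TangentSpace 𝓘(ℝ, E) x →L[ℝ] E))
      fun y ↦ B y w) x v = a x (D (fun y ↦ B y w) x v) := by
    have h2 : HasFDerivAt (fun y ↦ α y w) ((ContinuousLinearMap.apply ℝ E w).comp
        ((ContinuousLinearMap.mul ℝ (E →L[ℝ] E) (α (φ x))).comp (Γ (φ x)))) (φ x) :=
      (ContinuousLinearMap.apply ℝ E w).hasFDerivAt.comp _ hαx
    rw [mvfderiv_congr (g := fun y ↦ α (φ y) w),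
      mvfderiv_comp_extChartAt (f := fun y ↦ α y w) (hNs hx.1) h2.differentiableAt, h2.fderiv]
    · change α (φ x) (Γ (φ x) (c x v) w) = _
      rw [← ContinuousLinearEquiv.coe_coe, ha x hx]
      simp only [Γ, hφs x hx.1, christoffelForm_apply, hBc x hx.1]
      rfl
    · filter_upwards [(hN.inter hN₁o).mem_nhds hx] with y hy
      simp only [pairing, ha y hy]
      exact congrArg (α (φ y)) (hcB y hy.1 w)
  rw [hd] at h
  simp only [ContinuousLinearEquiv.coe_coe, sub_self, sub_eq_zero] at h
  exact h.symm

end LocalParallelCoframe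

/-! ### Gluing local parallel coframes. -/

section GlobalParallelCoframe

open Set Filter Topology VectorField

variable {E : Type*} [NormedAddCommGroup E] [NormedSpace ℝ E]
  {M : Type*} [TopologicalSpace M] [ChartedSpace E M] [IsManifold 𝓘(ℝ, E) ∞ M]
  {V : Type*} [NormedAddCommGroup V] [NormedSpace ℝ V]
  {W : Type*} [NormedAddCommGroup W] [NormedSpace ℝ W]
  {D : CovariantDerivative 𝓘(ℝ, E) E (TangentSpace 𝓘(ℝ, E) : M → Type _)}

theorem SmoothFormAt.congr_of_eventuallyEq {θ θ' : Π x : M, TangentSpace 𝓘(ℝ, E) x →L[ℝ] V} {x : M}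
    (hθ : SmoothFormAt θ x) (h : ∀ᶠ y in 𝓝 x, θ' y = θ y) : SmoothFormAt θ' x := by
  intro v
  refine (hθ v).congr_of_eventuallyEq ?_
  have hp : ContinuousAt (fun p : TangentBundle 𝓘(ℝ, E) M ↦ p.proj) ⟨x, v⟩ :=
    (FiberBundle.continuous_proj E (TangentSpace 𝓘(ℝ, E) : M → Type _)).continuousAt
  filter_upwards [hp.eventually h] with p hp
  rw [hp]

theorem SmoothFormAt.clm_comp {θ : Π x : M, TangentSpace 𝓘(ℝ, E) x →L[ℝ] V} {x : M}
    (hθ : SmoothFormAt θ x) (L : V →L[ℝ] W) : SmoothFormAt (fun y ↦ L.comp (θ y)) x :=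
  fun v ↦ L.contDiff.contMDiff.contMDiffAt.comp _ (hθ v)

theorem IsParallelAt.congr_of_eventuallyEq {θ θ' : Π x : M, TangentSpace 𝓘(ℝ, E) x →L[ℝ] V} {x : M}
    (hθ : IsParallelAt D θ x) (h : ∀ᶠ y in 𝓝 x, θ' y = θ y) : IsParallelAt D θ' x := by
  intro Y hY v
  rw [h.self_of_nhds, ← hθ Y hY, mvfderiv_congr]
  filter_upwards [h] with y hy
  simp only [pairing, hy]

theorem IsParallelAt.clm_comp {θ : Π x : M, TangentSpace 𝓘(ℝ, E) x →L[ℝ] V} {x : M}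
    (h : IsParallelAt D θ x) (hθ : SmoothFormAt θ x) (L : V →L[ℝ] W) :
    IsParallelAt D (fun y ↦ L.comp (θ y)) x := by
  intro Y hY v
  have h1 := (hθ.mdifferentiableAt_pairing hY).hasMFDerivAt
  have h2 := (L.hasFDerivAt.hasMFDerivAt.comp x h1).mfderiv
  have h3 : mvfderiv 𝓘(ℝ, E) (pairing (fun y ↦ L.comp (θ y)) Y) x v =
      L (mvfderiv 𝓘(ℝ, E) (pairing θ Y) x v) :=
    congrArg (fun T : E →L[ℝ] W ↦ T v) h2
  rw [h3, h Y hY]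
  rfl

variable {a : Π x : M, TangentSpace 𝓘(ℝ, E) x ≃L[ℝ] E} {N : Set M}

/-- The dual frame of a parallel coframe is parallel. -/
theorem IsParallelAt.covariantDerivative_symm [FiniteDimensional ℝ E] {x : M}
    (hs : SmoothFormAt (fun x ↦ (a x : TangentSpace 𝓘(ℝ, E) x →L[ℝ] E)) x)
    (hp : IsParallelAt D (fun x ↦ (a x : TangentSpace 𝓘(ℝ, E) x →L[ℝ] E)) x) (u : E) :
    D (fun y ↦ (a y).symm u) x = 0 := by
  ext v
  have h := hp _ ((hs.contMDiffAt_symm u).mdifferentiableAt (by simp)) v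
  have h1 : pairing (fun x ↦ (a x : TangentSpace 𝓘(ℝ, E) x →L[ℝ] E))
      (fun y ↦ (a y).symm u) = fun _ ↦ u := by
    ext y; exact (a y).apply_symm_apply u
  rw [h1, mvfderiv_const] at h
  exact (a x).map_eq_zero_iff.1 h.symm

/-- On a simply connected manifold, a flat connection admits a global parallel coframe. -/
theorem IsFlat.exists_parallel_coframe [FiniteDimensional ℝ E] [T2Space M] [SimplyConnectedSpace M]
    [CovariantDerivative.ContMDiffCovariantDerivative D ∞] (hD : IsFlat D) :
    ∃ a : Π x : M, TangentSpace 𝓘(ℝ, E) x ≃L[ℝ] E,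
      ∀ x, SmoothFormAt (fun x ↦ (a x : TangentSpace 𝓘(ℝ, E) x →L[ℝ] E)) x ∧
        IsParallelAt D (fun x ↦ (a x : TangentSpace 𝓘(ℝ, E) x →L[ℝ] E)) x := by
  have : LocallyPathConnectedSpace M := ChartedSpace.locallyPathConnectedSpace E M
  choose N hN hmem a ha using fun x₀ : M ↦ hD.exists_local_parallel_coframe D x₀
  have hconst : ∀ i j, ∀ x ∈ N i ∩ N j, ∀ᶠ y in 𝓝 x,
      (a j y).symm.trans (a i y) = (a j x).symm.trans (a i x) := by
    intro i j x hx
    have hv : ∀ v : E, ∀ᶠ y in 𝓝 x, a i y ((a j y).symm v) = a i x ((a j x).symm v) := by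
      intro v
      have hY : ∀ y ∈ N i ∩ N j, MDifferentiableAt 𝓘(ℝ, E) 𝓘(ℝ, E).tangent
          (fun y ↦ (⟨y, (a j y).symm v⟩ : TangentBundle 𝓘(ℝ, E) M)) y := fun y hy ↦
        ((ha j y hy.2).1.contMDiffAt_symm v).mdifferentiableAt (by simp)
      -- The parallel coframe `a i` is paired with a field of the parallel frame dual to `a j`, so
      -- the derivative is zero.
      refine eventually_eq_of_mvfderiv_eq_zero ((hN i).inter (hN j))
        (f := pairing (fun y ↦ (a i y : TangentSpace 𝓘(ℝ, E) y →L[ℝ] E))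
          fun y ↦ (a j y).symm v)
        (fun y hy ↦ (ha i y hy.1).1.mdifferentiableAt_pairing (hY y hy)) (fun y hy ↦ ?_) hx
      ext w
      rw [(ha i y hy.1).2 _ (hY y hy),
        (ha j y hy.2).2.covariantDerivative_symm (ha j y hy.2).1]
      simp
    -- A finite basis yields one neighbourhood that serves all vectors.
    let b := Module.finBasis ℝ E
    filter_upwards [eventually_all.2 fun k ↦ hv (b k)] with y hy
    refine ContinuousLinearEquiv.toLinearEquiv_injective (LinearEquiv.toLinearMap_injective
      (b.ext fun k ↦ ?_))
    exact hy k
  -- The cocycle is `g i j = a i ∘ (a j)⁻¹`, so the coboundary relation says that `h i ∘ a i` does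
  -- not depend on `i`.
  obtain ⟨h, hloc, hh⟩ := exists_coboundary_of_locallyConstant_cocycle (G := E ≃L[ℝ] E) N hN
    (fun x ↦ ⟨x, hmem x⟩) (fun i j x ↦ (a j x).symm.trans (a i x)) hconst
    (fun i x _ ↦ (a i x).symm_trans_self) (fun i j k x _ ↦ by
      ext v
      change a i x ((a j x).symm (a j x ((a k x).symm v))) = a i x ((a k x).symm v)
      rw [(a j x).symm_apply_apply])
  have hglue : ∀ i x, x ∈ N i → (a x x).trans (h x x) = (a i x).trans (h i x) := by
    intro i x hx
    rw [← hh i x x ⟨hx, hmem x⟩]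
    ext v
    change h i x (a i x ((a x x).symm (a x x v))) = h i x (a i x v)
    rw [(a x x).symm_apply_apply]
  refine ⟨fun x ↦ (a x x).trans (h x x), fun x ↦ ?_⟩
  have hev : ∀ᶠ y in 𝓝 x, ((a y y).trans (h y y) : TangentSpace 𝓘(ℝ, E) y →L[ℝ] E) =
      (h x x : E →L[ℝ] E).comp (a x y : TangentSpace 𝓘(ℝ, E) y →L[ℝ] E) := by
    filter_upwards [hloc x x (hmem x), (hN x).mem_nhds (hmem x)] with y hy hyN
    rw [hglue x y hyN, hy]
    rfl
  obtain ⟨hs, hp⟩ := ha x x (hmem x)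
  exact ⟨(hs.clm_comp (h x x : E →L[ℝ] E)).congr_of_eventuallyEq hev,
    (hp.clm_comp hs (h x x : E →L[ℝ] E)).congr_of_eventuallyEq hev⟩

end GlobalParallelCoframe

/-! ### Brackets of a frame parallel for the dual connection. -/

section ParallelFrame

open Set Filter Topology VectorField

variable {E : Type*} [NormedAddCommGroup E] [NormedSpace ℝ E] [FiniteDimensional ℝ E]
  {M : Type*} [TopologicalSpace M] [ChartedSpace E M] [IsManifold 𝓘(ℝ, E) ∞ M]
  {D D' : CovariantDerivative 𝓘(ℝ, E) E (TangentSpace 𝓘(ℝ, E) : M → Type _)}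
  {a : Π x : M, TangentSpace 𝓘(ℝ, E) x ≃L[ℝ] E}

omit [FiniteDimensional ℝ E] in
theorem IsSmoothField.mlieBracket [CompleteSpace E] {X Y : Π x : M, TangentSpace 𝓘(ℝ, E) x}
    (hX : IsSmoothField X) (hY : IsSmoothField Y) :
    IsSmoothField (mlieBracket 𝓘(ℝ, E) X Y) := by
  intro x
  have : IsManifold 𝓘(ℝ, E) (((⊤ : ℕ∞) : ℕ∞ω) + 1) M := by simpa using! ‹IsManifold 𝓘(ℝ, E) ∞ M›
  have : IsManifold 𝓘(ℝ, E) (minSmoothness ℝ 2) M := by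
    rw [minSmoothness_of_isRCLikeNormedField]
    exact IsManifold.of_le (n := ∞) ENat.LEInfty.out
  refine ContMDiffAt.mlieBracket_vectorField (m := ⊤) (n := ⊤) (hX.contMDiffAt x)
    (hY.contMDiffAt x) ?_
  rw [minSmoothness_of_isRCLikeNormedField]
  simp

theorem IsSmoothField.leibniz_mlieBracket {X Y Z : Π x : M, TangentSpace 𝓘(ℝ, E) x}
    (hX : IsSmoothField X) (hY : IsSmoothField Y) (hZ : IsSmoothField Z) (x : M) :
    VectorField.mlieBracket 𝓘(ℝ, E) X (VectorField.mlieBracket 𝓘(ℝ, E) Y Z) x =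
      VectorField.mlieBracket 𝓘(ℝ, E) (VectorField.mlieBracket 𝓘(ℝ, E) X Y) Z x +
        VectorField.mlieBracket 𝓘(ℝ, E) Y (VectorField.mlieBracket 𝓘(ℝ, E) X Z) x := by
  have : IsManifold 𝓘(ℝ, E) (minSmoothness ℝ 3) M := by
    rw [minSmoothness_of_isRCLikeNormedField]
    exact IsManifold.of_le (n := ∞) ENat.LEInfty.out
  have h : minSmoothness ℝ 2 ≤ ∞ := by
    rw [minSmoothness_of_isRCLikeNormedField]; exact ENat.LEInfty.out
  exact leibniz_identity_mlieBracket_apply ((hX.contMDiffAt x).of_le h)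
    ((hY.contMDiffAt x).of_le h) ((hZ.contMDiffAt x).of_le h)

theorem isSmoothField_symm
    (hs : ∀ x, SmoothFormAt (fun x ↦ (a x : TangentSpace 𝓘(ℝ, E) x →L[ℝ] E)) x) (u : E) :
    IsSmoothField fun x ↦ (a x).symm u :=
  fun x ↦ (hs x).contMDiffAt_symm u

omit [FiniteDimensional ℝ E] in
theorem IsDualPair.nabla_eq (hdual : IsDualPair D D') {X Y : Π x : M, TangentSpace 𝓘(ℝ, E) x}
    (hX : IsSmoothField X) (hY : IsSmoothField Y) (x : M) :
    nabla D X Y x = nabla D' Y X x + mlieBracket 𝓘(ℝ, E) X Y x := by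
  rw [hdual Y X hY hX x, mlieBracket_swap_apply (V := Y)]
  abel

/-- If `∇` is flat, then the bracket of two fields parallel for the dual connection is parallel
for the dual connection. -/
theorem IsDualPair.covariantDerivative_mlieBracket (hdual : IsDualPair D D') (hD : IsFlat D)
    (hs : ∀ x, SmoothFormAt (fun x ↦ (a x : TangentSpace 𝓘(ℝ, E) x →L[ℝ] E)) x)
    (hp : ∀ x, IsParallelAt D' (fun x ↦ (a x : TangentSpace 𝓘(ℝ, E) x →L[ℝ] E)) x)
    (u v : E) (x : M) :
    D' (mlieBracket 𝓘(ℝ, E) (fun x ↦ (a x).symm u) fun x ↦ (a x).symm v) x = 0 := by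
  set P : E → Π x : M, TangentSpace 𝓘(ℝ, E) x := fun u x ↦ (a x).symm u
  have hP : ∀ u, IsSmoothField (P u) := isSmoothField_symm hs
  have h0 : ∀ u x, D' (P u) x = 0 := fun u x ↦ (hp x).covariantDerivative_symm (hs x) u
  -- As `P u` is parallel for `D'`, duality makes `D` along `P u` the Lie derivative.
  have h1 : ∀ (u : E) (Z : Π x : M, TangentSpace 𝓘(ℝ, E) x), IsSmoothField Z →
      nabla D (P u) Z = mlieBracket 𝓘(ℝ, E) (P u) Z := by
    intro u Z hZ
    ext x
    rw [hdual.nabla_eq (hP u) hZ, nabla, h0]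
    simp
  have hbr : ∀ u v, IsSmoothField (mlieBracket 𝓘(ℝ, E) (P u) (P v)) := fun u v ↦
    (hP u).mlieBracket (hP v)
  ext y
  obtain ⟨w, rfl⟩ := (a x).symm.surjective y
  -- After the Jacobi identity, only `D'_{P w} [P u, P v]` survives in the curvature.
  have h := hD _ _ _ (hP u) (hP v) (hP w) x
  rw [h1 v _ (hP w), h1 u _ (hP w), h1 u _ (hbr v w), h1 v _ (hbr u w),
    hdual.nabla_eq (hbr u v) (hP w), (hP u).leibniz_mlieBracket (hP v) (hP w)] at h
  have h2 : nabla D' (P w) (mlieBracket 𝓘(ℝ, E) (P u) (P v)) x = 0 := by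
    rw [← neg_eq_zero, ← h]
    abel
  simpa using! h2

/-- The structure functions of a parallel frame of the dual connection are constant. -/
theorem IsDualPair.mlieBracket_eq [PreconnectedSpace M] (hdual : IsDualPair D D') (hD : IsFlat D)
    (hs : ∀ x, SmoothFormAt (fun x ↦ (a x : TangentSpace 𝓘(ℝ, E) x →L[ℝ] E)) x)
    (hp : ∀ x, IsParallelAt D' (fun x ↦ (a x : TangentSpace 𝓘(ℝ, E) x →L[ℝ] E)) x)
    (u v : E) (x y : M) :
    a x (mlieBracket 𝓘(ℝ, E) (fun x ↦ (a x).symm u) (fun x ↦ (a x).symm v) x) =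
      a y (mlieBracket 𝓘(ℝ, E) (fun x ↦ (a x).symm u) (fun x ↦ (a x).symm v) y) := by
  have hK := (isSmoothField_symm hs u).mlieBracket (isSmoothField_symm hs v)
  set K := mlieBracket 𝓘(ℝ, E) (fun x ↦ (a x).symm u) fun x ↦ (a x).symm v with hKdef
  have h : IsLocallyConstant
      (pairing (fun x ↦ (a x : TangentSpace 𝓘(ℝ, E) x →L[ℝ] E)) K) := by
    refine (IsLocallyConstant.iff_eventually_eq _).2 fun x ↦
      eventually_eq_of_mvfderiv_eq_zero isOpen_univ
        (fun y _ ↦ (hs y).mdifferentiableAt_pairing (hK.mdifferentiableAt y))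
        (fun y _ ↦ ?_) (mem_univ x)
    ext w
    rw [hp y _ (hK.mdifferentiableAt y), hKdef,
      hdual.covariantDerivative_mlieBracket hD hs hp]
    simp
  exact h.apply_eq_of_preconnectedSpace x y

/-- The exterior derivative of a parallel coframe is minus the torsion, computed in the dual
frame. -/
theorem extDerivForm_eq_neg_mlieBracket
    (hs : ∀ x, SmoothFormAt (fun x ↦ (a x : TangentSpace 𝓘(ℝ, E) x →L[ℝ] E)) x)
    (hp : ∀ x, IsParallelAt D' (fun x ↦ (a x : TangentSpace 𝓘(ℝ, E) x →L[ℝ] E)) x)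
    {X Y : Π x : M, TangentSpace 𝓘(ℝ, E) x} (hX : IsSmoothField X) (hY : IsSmoothField Y) (x : M) :
    extDerivForm (fun x ↦ (a x : TangentSpace 𝓘(ℝ, E) x →L[ℝ] E)) X Y x =
      - a x (mlieBracket 𝓘(ℝ, E) (fun y ↦ (a y).symm (a x (X x)))
        (fun y ↦ (a y).symm (a x (Y x))) x) := by
  have : IsManifold 𝓘(ℝ, E) 2 M := IsManifold.of_le (n := ∞) ENat.LEInfty.out
  -- The torsion at `x` is written twice, with `X, Y` and with the frame fields of the same values,
  -- whose covariant derivatives vanish.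
  have h1 := D'.torsion_apply (hX.mdifferentiableAt x) (hY.mdifferentiableAt x)
  have h2 := D'.torsion_apply ((isSmoothField_symm hs (a x (X x))).mdifferentiableAt x)
    ((isSmoothField_symm hs (a x (Y x))).mdifferentiableAt x)
  rw [(hp x).covariantDerivative_symm (hs x), (hp x).covariantDerivative_symm (hs x),
    (a x).symm_apply_apply, (a x).symm_apply_apply, h1] at h2
  rw [extDerivForm, lieDerivFun, lieDerivFun, hp x _ (hY.mdifferentiableAt x),
    hp x _ (hX.mdifferentiableAt x), pairing, ← map_sub, ← map_sub, h2]
  simp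

end ParallelFrame

/-! ### Lie algebra structure from a bilinear bracket. -/

section LieAlgebra

variable {E : Type*} [NormedAddCommGroup E] [NormedSpace ℝ E]

/-- The Lie ring structure given by an alternating bilinear bracket with the Leibniz identity. -/
abbrev NormedLieRing.ofBracket (β : E →ₗ[ℝ] E →ₗ[ℝ] E) (hself : ∀ u, β u u = 0)
    (hjac : ∀ u v w, β u (β v w) = β (β u v) w + β v (β u w)) : NormedLieRing E where
  bracket u v := β u v
  add_lie u v w := by simp
  lie_add u v w := by simp
  lie_self := hself
  leibniz_lie := hjac

/-- The Lie algebra structure of `NormedLieRing.ofBracket`. -/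
abbrev NormedLieAlgebra.ofBracket (β : E →ₗ[ℝ] E →ₗ[ℝ] E) (hself : ∀ u, β u u = 0)
    (hjac : ∀ u v w, β u (β v w) = β (β u v) w + β v (β u w)) :
    letI := NormedLieRing.ofBracket β hself hjac
    NormedLieAlgebra E :=
  letI := NormedLieRing.ofBracket β hself hjac
  { (inferInstance : NormedSpace ℝ E) with
    lie_smul := fun r u v ↦ map_smul (β u) r v }

end LieAlgebra

end DualConnections

/-! ### Assembly of the parallelism and its Lie algebra. -/

open DualConnections in
theorem corollary3p1
    {E : Type u} [NormedAddCommGroup E] [NormedSpace ℝ E] [FiniteDimensional ℝ E]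
    {M : Type v} [TopologicalSpace M] [T2Space M] [ChartedSpace E M]
    [IsManifold 𝓘(ℝ, E) ∞ M] [SimplyConnectedSpace M]
    (D D' : CovariantDerivative 𝓘(ℝ, E) E (TangentSpace 𝓘(ℝ, E) : M → Type _))
    [CovariantDerivative.ContMDiffCovariantDerivative D ∞]
    [CovariantDerivative.ContMDiffCovariantDerivative D' ∞]
    (hdual : IsDualPair D D') (hD : IsFlat D) (hD' : IsFlat D') :
    ∃ (𝔤₀ : Type u) (_ : NormedLieRing 𝔤₀) (_ : NormedLieAlgebra 𝔤₀)
      (_ : FiniteDimensional ℝ 𝔤₀) (θ : Π x : M, TangentSpace 𝓘(ℝ, E) x →L[ℝ] 𝔤₀),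
      IsAbsoluteParallelism θ ∧ MaurerCartan θ ∧
      ∀ X Y : Π x : M, TangentSpace 𝓘(ℝ, E) x, IsSmoothField X → IsSmoothField Y → ∀ x,
        θ x (nabla D X Y x) = lieDerivForm Y θ X x ∧
        θ x (nabla D' X Y x) = lieDerivFun X (pairing θ Y) x := by
  obtain ⟨a, ha⟩ := hD'.exists_parallel_coframe
  have hs := fun x ↦ (ha x).1
  have hp := fun x ↦ (ha x).2
  obtain ⟨x₀⟩ : Nonempty M := inferInstance
  set P : E → Π x : M, TangentSpace 𝓘(ℝ, E) x := fun u x ↦ (a x).symm u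
  have hP : ∀ u x, MDifferentiableAt 𝓘(ℝ, E) 𝓘(ℝ, E).tangent
      (fun x ↦ (⟨x, P u x⟩ : TangentBundle 𝓘(ℝ, E) M)) x := fun u x ↦
    (isSmoothField_symm hs u).mdifferentiableAt x
  have hadd : ∀ u v, P (u + v) = P u + P v := fun u v ↦ by ext x; exact map_add _ _ _
  have hsmul : ∀ (r : ℝ) u, P (r • u) = r • P u := fun r u ↦ by ext x; exact map_smul _ _ _
  let β : E →ₗ[ℝ] E →ₗ[ℝ] E := LinearMap.mk₂ ℝ
    (fun u v ↦ a x₀ (VectorField.mlieBracket 𝓘(ℝ, E) (P u) (P v) x₀))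
    (fun u u' v ↦ by
      rw [hadd, VectorField.mlieBracket_add_left (hP u x₀) (hP u' x₀), map_add])
    (fun r u v ↦ by
      rw [hsmul, VectorField.mlieBracket_const_smul_left (hP u x₀), map_smul])
    (fun u v v' ↦ by
      rw [hadd, VectorField.mlieBracket_add_right (hP v x₀) (hP v' x₀), map_add])
    (fun r u v ↦ by
      rw [hsmul, VectorField.mlieBracket_const_smul_right (hP v x₀), map_smul])
  -- Flatness of `D` makes the base point `x₀` immaterial.
  have hβ : ∀ u v x, a x (VectorField.mlieBracket 𝓘(ℝ, E) (P u) (P v) x) = β u v := fun u v x ↦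
    hdual.mlieBracket_eq hD hs hp u v x x₀
  -- `P` turns `β` into the bracket of vector fields, so the Jacobi identity can be pulled back.
  have hPβ : ∀ u v, P (β u v) = VectorField.mlieBracket 𝓘(ℝ, E) (P u) (P v) := fun u v ↦ by
    ext x
    rw [← hβ u v x]
    exact (a x).symm_apply_apply _
  have hself : ∀ u, β u u = 0 := fun u ↦ by
    rw [← hβ u u x₀, VectorField.mlieBracket_self]; exact map_zero _
  have hjac : ∀ u v w, β u (β v w) = β (β u v) w + β v (β u w) := fun u v w ↦ by
    have h1 := hβ u (β v w) x₀
    have h2 := hβ (β u v) w x₀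
    have h3 := hβ v (β u w) x₀
    rw [hPβ] at h1 h2 h3
    rw [← h1, ← h2, ← h3, ← map_add, (isSmoothField_symm hs u).leibniz_mlieBracket (isSmoothField_symm hs v)
        (isSmoothField_symm hs w)]
  have hanti : ∀ u v, β u v = - β v u := fun u v ↦ by
    have h := hself (u + v)
    simp only [map_add, LinearMap.add_apply, hself] at h
    rw [zero_add, add_zero] at h
    exact eq_neg_of_add_eq_zero_right h
  refine ⟨E, NormedLieRing.ofBracket β hself hjac, NormedLieAlgebra.ofBracket β hself hjac,
    ‹FiniteDimensional ℝ E›, fun x ↦ (a x : TangentSpace 𝓘(ℝ, E) x →L[ℝ] E),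
    ⟨fun p ↦ hs p.proj p.snd, fun x ↦ (a x).bijective⟩, fun X Y hX hY x ↦ ?_,
    fun X Y hX hY x ↦ ?_⟩
  · have h := extDerivForm_eq_neg_mlieBracket hs hp hX hY x
    -- By antisymmetry the difference is twice `β`, which the factor `1 / 2` compensates.
    have h1 : extDerivForm (fun x ↦ (a x : TangentSpace 𝓘(ℝ, E) x →L[ℝ] E)) X Y x +
        (1 / 2 : ℝ) • (β (a x (X x)) (a x (Y x)) - β (a x (Y x)) (a x (X x))) = 0 := by
      rw [h, hβ, hanti (a x (Y x))]
      module
    exact h1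
  · have h2 : ∀ {X Y : Π x : M, TangentSpace 𝓘(ℝ, E) x}, IsSmoothField Y →
        a x (nabla D' X Y x) = lieDerivFun X
          (pairing (fun x ↦ (a x : TangentSpace 𝓘(ℝ, E) x →L[ℝ] E)) Y) x := fun hY ↦
      (hp x _ (hY.mdifferentiableAt x) _).symm
    -- From `D_X Y = D'_Y X - [Y, X]`, where parallelism makes the first term `Y(θ(X))`.
    have h1 : a x (nabla D X Y x) =
        lieDerivForm Y (fun x ↦ (a x : TangentSpace 𝓘(ℝ, E) x →L[ℝ] E)) X x := by
      rw [hdual.nabla_eq hX hY, VectorField.mlieBracket_swap_apply, ← sub_eq_add_neg, map_sub,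
        h2 hX]
      rfl
    exact ⟨h1, h2 hY⟩
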